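/- Let $A$ be the $\{0,1\}$-matrix over the alphabet $\mathbb N=\{1,2,3,\dots\}$ with $A(1,n)=A(n+1,n)=1$ for all $n\in\mathbb N$ and all other entries $0$ (the renewal shift), and let $\Sigma_A=\{x\in\mathbb N^{\{0,1,2,\dots\}}: A(x_j,x_{j+1})=1\ \text{for all } j\}$. On $\ell^2(\Sigma_A)$, with canonical basis $(\delta_x)_{x\in\Sigma_A}$, let $T_s$ ($s\in\mathbb N$) be the partial isometry with $T_s\delta_x=\delta_{sx}$ if $A(s,x_0)=1$ and $T_s\delta_x=0$ otherwise, and let $Q_s=T_s^*T_s$. Let $\mathcal D_A$ be the commutative unital $C^*$-algebra $$\mathcal D_A=\overline{\operatorname{span}}\Big\{T_\alpha\Big(\prod_{i\in F}Q_i\Big)T_\alpha^*:\ \alpha \text{ a finite (possibly empty) word},\ F\subset\mathbb N\text{ finite}\Big\},$$ and let $X_A$ be its spectrum (the characters of $\mathcal D_A$ with the weak-$*$ topology), with its Borel $\sigma$-algebra. Identify $\omega\in\Sigma_A$ with the character $R\mapsto (R\delta_\omega,\delta_\omega)$, so that $\Sigma_A\subset X_A$. Identify $\xi\in X_A$ with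 its configuration $(\xi_g)_{g\in\mathbb F}$ over the free group $\mathbb F$ generated by $\mathbb N$, where $\xi_g=\xi(T_gT_g^*)\in\{0,1\}$ and $T_g$ is the product of the operators $T_s$, $T_{s^{-1}}:=T_s^*$ along the reduced form of $g$. There is exactly one point $\xi^0\in X_A$ with $\xi^0_s=0$ for every letter $s$. For $\xi\in X_A\setminus\{\xi^0\}$ there is a unique letter $s$ with $\xi_s=1$, called the first coordinate $\omega_0=\omega_0(\xi)$ of $\xi$, and the shift $\sigma:X_A\setminus\{\xi^0\}\to X_A$ is given by $\sigma(\xi)_g=\xi_{\omega_0 g}$, i.e. $\sigma(\xi)(R)=\xi(T_{\omega_0}RT_{\omega_0}^*)$ for $R\in\mathcal D_A$. For a measurable $D:X_A\setminus\{\xi^0\}\to[0,\infty)$, a Borel measure $\mu$ on $X_A$ is called $D$-conformal (in the sense of Denker and Urbański) if $\mu(\sigma(E))=\int_E D\,d\mu$ for every Borel set $E\subseteq X_A\setminus\{\xi^0\}$ on which $\sigma$ is injective. **Theorem.** Let $f:X_A\setminus\{\xi^0\}\to\mathbb R$ be a bounded function which depends only on the first coordinate and satisfies $f\ge M$ for some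 constant $M>0$. Let $\|f\|_\infty=\sup|f|$ and let $\beta>0$. (i) If $\beta>\frac{\log 2}{M}$, there exists a unique $e^{\beta f}$-conformal Borel probability measure $\mu_\beta$ on $X_A$ with $\mu_\beta(\Sigma_A)=0$. (ii) If $\beta<\frac{\log 2}{\|f\|_\infty}$, there is no $e^{\beta f}$-conformal Borel probability measure $\mu$ on $X_A$ with $\mu(\Sigma_A)=0$. -/

import Mathlib

open scoped ENNReal NNReal InnerProductSpace

noncomputable section

namespace ExelLaca

/-- The Markov shift space `Σ_A` over the alphabet `{1, 2, 3, …}` of a `0`-`1` matrix `A`. -/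
def MarkovShift (A : Matrix ℕ+ ℕ+ ℕ) : Type :=
  {x : ℕ → ℕ+ // ∀ j, A (x j) (x (j + 1)) = 1}

namespace MarkovShift

variable {A : Matrix ℕ+ ℕ+ ℕ}

/-- The shift map of `Σ_A`. -/
def tail (x : MarkovShift A) : MarkovShift A :=
  ⟨fun j => x.1 (j + 1), fun j => x.2 (j + 1)⟩

/-- The sequence `s x₀ x₁ x₂ …`, when `A(s, x₀) = 1`. -/
def cons (s : ℕ+) (x : MarkovShift A) (h : A s (x.1 0) = 1) : MarkovShift A :=
  ⟨fun j => Nat.casesOn j s x.1, fun j => by cases j with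
    | zero => exact h
    | succ j => exact x.2 j⟩

theorem cons_tail (x : MarkovShift A) (s : ℕ+) (hs : x.1 0 = s) (h : A s (x.tail.1 0) = 1) :
    cons s x.tail h = x := by
  apply Subtype.ext
  funext j
  cases j with
  | zero => exact hs.symm
  | succ j => rfl

theorem tail_cons (s : ℕ+) (x : MarkovShift A) (h : A s (x.1 0) = 1) :
    (cons s x h).tail = x := rfl

theorem tail_edge (x : MarkovShift A) (s : ℕ+) (hs : x.1 0 = s) : A s (x.tail.1 0) = 1 := by
  subst hs; exact x.2 0

theorem tail_injOn (s : ℕ+) :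
    Function.Injective (fun y : {y : MarkovShift A // y.1 0 = s} => y.1.tail) := by
  intro y z h
  apply Subtype.ext
  rw [← cons_tail y.1 s y.2 (tail_edge _ _ y.2), ← cons_tail z.1 s z.2 (tail_edge _ _ z.2)]
  simp only at h
  congr 1

end MarkovShift

open MarkovShift

/-- The Hilbert space `ℓ²(Σ_A)`. -/
abbrev Hil (A : Matrix ℕ+ ℕ+ ℕ) : Type := lp (fun _ : MarkovShift A => ℂ) 2

open Classical in
/-- The canonical basis vector `δ_x` of `ℓ²(Σ_A)`. -/
def delta {A : Matrix ℕ+ ℕ+ ℕ} (x : MarkovShift A) : Hil A := lp.single 2 x (1 : ℂ)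

open Classical in
theorem delta_apply {A : Matrix ℕ+ ℕ+ ℕ} (x y : MarkovShift A) :
    delta x y = if y = x then (1 : ℂ) else 0 := by
  unfold delta
  rw [lp.single_apply]
  by_cases hy : y = x
  · subst hy; simp
  · simp [hy]

open Classical in
theorem inner_delta {A : Matrix ℕ+ ℕ+ ℕ} (x : MarkovShift A) (v : Hil A) :
    ⟪delta x, v⟫_ℂ = v x := by
  unfold delta
  rw [lp.inner_single_left]
  simp

variable {A : Matrix ℕ+ ℕ+ ℕ}

theorem summable_T (s : ℕ+) (v : Hil A) :
    Summable (fun y : {y : MarkovShift A // y.1 0 = s} => ‖v y.1.tail‖ ^ 2) := by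
  have h := (lp.memℓp v).summable (by simp)
  simp only [ENNReal.toReal_ofNat, Real.rpow_ofNat] at h
  exact h.comp_injective (tail_injOn s)

/-- The function `y ↦ [y₀ = s] v(y₁ y₂ …)`. -/
def Tfun (A : Matrix ℕ+ ℕ+ ℕ) (s : ℕ+) (v : MarkovShift A → ℂ) : MarkovShift A → ℂ :=
  fun y => if y.1 0 = s then v y.tail else 0

theorem Tfun_sq (s : ℕ+) (v : Hil A) :
    (fun y => ‖Tfun A s v y‖ ^ 2) =
      Set.indicator {y : MarkovShift A | y.1 0 = s} (fun y => ‖v y.tail‖ ^ 2) := by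
  funext y
  by_cases h : y.1 0 = s <;> simp [Tfun, h]

theorem Tfun_mem (s : ℕ+) (v : Hil A) : Memℓp (Tfun A s v) 2 := by
  apply memℓp_gen
  simp only [ENNReal.toReal_ofNat, Real.rpow_ofNat]
  rw [Tfun_sq]
  exact summable_subtype_iff_indicator.mp (summable_T s v)

theorem Tfun_norm_le (s : ℕ+) (v : Hil A) : ‖(⟨Tfun A s v, Tfun_mem s v⟩ : Hil A)‖ ≤ 1 * ‖v‖ := by
  rw [one_mul]
  have h1 := lp.norm_rpow_eq_tsum (p := 2) (by simp) v
  have h2 := lp.norm_rpow_eq_tsum (p := 2) (by simp) (⟨Tfun A s v, Tfun_mem s v⟩ : Hil A)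
  have h := (lp.memℓp v).summable (by simp)
  simp only [ENNReal.toReal_ofNat, Real.rpow_ofNat] at h1 h2 h
  have h3 : ‖(⟨Tfun A s v, Tfun_mem s v⟩ : Hil A)‖ ^ 2 ≤ ‖v‖ ^ 2 := by
    rw [h1, h2]
    change ∑' y, ‖Tfun A s v y‖ ^ 2 ≤ _
    rw [Tfun_sq, ← tsum_subtype]
    exact Summable.tsum_le_tsum_of_inj (fun y : {y : MarkovShift A // y.1 0 = s} => y.1.tail)
      (tail_injOn s) (fun _ _ => by positivity) (fun _ => le_rfl) (summable_T s v) h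
  exact (pow_le_pow_iff_left₀ (norm_nonneg _) (norm_nonneg _) two_ne_zero).mp h3

/-- The partial isometry `T_s` of `ℓ²(Σ_A)`: `T_s δ_x = δ_{sx}` if `A(s, x₀) = 1`, and
`T_s δ_x = 0` otherwise (see `T_delta` and `T_delta_of_ne`). -/
def T (A : Matrix ℕ+ ℕ+ ℕ) (s : ℕ+) : Hil A →L[ℂ] Hil A :=
  LinearMap.mkContinuous
    { toFun := fun v => ⟨Tfun A s v, Tfun_mem s v⟩
      map_add' := fun v w => by
        ext y
        change Tfun A s _ y = Tfun A s _ y + Tfun A s _ y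
        by_cases h : y.1 0 = s <;> simp [Tfun, h]
      map_smul' := fun c v => by
        ext y
        change Tfun A s _ y = c * Tfun A s _ y
        by_cases h : y.1 0 = s <;> simp [Tfun, h] } 1 (Tfun_norm_le s)

theorem T_apply (s : ℕ+) (v : Hil A) (y : MarkovShift A) :
    T A s v y = if y.1 0 = s then v y.tail else 0 := rfl

theorem T_delta (s : ℕ+) (x : MarkovShift A) (h : A s (x.1 0) = 1) :
    T A s (delta x) = delta (cons s x h) := by
  classical
  ext y
  rw [T_apply, delta_apply, delta_apply]
  by_cases hy : y.1 0 = s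
  · have : y.tail = x ↔ y = cons s x h := by
      constructor
      · rintro rfl; exact (cons_tail y s hy h).symm
      · rintro rfl; rfl
    simp [hy, this]
  · have : y ≠ cons s x h := by rintro rfl; exact hy rfl
    simp [hy, this]

theorem T_delta_of_ne (s : ℕ+) (x : MarkovShift A) (h : A s (x.1 0) ≠ 1) :
    T A s (delta x) = 0 := by
  classical
  ext y
  rw [T_apply, delta_apply]
  split_ifs with hy hx
  · subst hx; exact absurd (tail_edge y s hy) h
  · rfl
  · rfl

theorem T_star_apply (s : ℕ+) (v : Hil A) (x : MarkovShift A) :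
    (star (T A s)) v x = if h : A s (x.1 0) = 1 then v (cons s x h) else 0 := by
  rw [← inner_delta, ContinuousLinearMap.star_eq_adjoint, ContinuousLinearMap.adjoint_inner_right]
  split_ifs with h
  · rw [T_delta s x h, inner_delta]
  · rw [T_delta_of_ne s x h, inner_zero_left]

/-- The projection `Q_s = T_s^* T_s`. -/
def Q (A : Matrix ℕ+ ℕ+ ℕ) (s : ℕ+) : Hil A →L[ℂ] Hil A := star (T A s) * T A s

/-- `T_α = T_{α₀} T_{α₁} ⋯` for a finite word `α`; it is `1` for the empty word. -/
def Tword (A : Matrix ℕ+ ℕ+ ℕ) (α : List ℕ+) : Hil A →L[ℂ] Hil A := (α.map (T A)).prod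

/-- The product of the (commuting) projections `Q_i`, `i` in a finite list. -/
def Qprod (A : Matrix ℕ+ ℕ+ ℕ) (F : List ℕ+) : Hil A →L[ℂ] Hil A := (F.map (Q A)).prod

/-- The operators `T_α (∏_{i ∈ F} Q_i) T_α^*`, with `α` a finite word and `F` finite. -/
def diagGenerators (A : Matrix ℕ+ ℕ+ ℕ) : Set (Hil A →L[ℂ] Hil A) :=
  {R | ∃ α F : List ℕ+, R = Tword A α * Qprod A F * star (Tword A α)}

/-- Operators that are diagonal in the canonical basis. -/
def IsDiag (R : Hil A →L[ℂ] Hil A) : Prop :=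
  ∃ r : MarkovShift A → ℂ, ∀ v y, R v y = r y * v y

theorem IsDiag.mul {R S : Hil A →L[ℂ] Hil A} (hR : IsDiag R) (hS : IsDiag S) :
    IsDiag (R * S) := by
  obtain ⟨r, hr⟩ := hR
  obtain ⟨s, hs⟩ := hS
  refine ⟨fun y => r y * s y, fun v y => ?_⟩
  rw [mul_apply_eq_comp, hr, hs, mul_assoc]

theorem IsDiag.comm {R S : Hil A →L[ℂ] Hil A} (hR : IsDiag R) (hS : IsDiag S) :
    R * S = S * R := by
  obtain ⟨r, hr⟩ := hR
  obtain ⟨s, hs⟩ := hS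
  ext v y
  rw [mul_apply_eq_comp, hr, hs, mul_apply_eq_comp, hs, hr]
  ring

theorem isDiag_one : IsDiag (1 : Hil A →L[ℂ] Hil A) := ⟨fun _ => 1, fun v y => by simp⟩

theorem IsDiag.conj {R : Hil A →L[ℂ] Hil A} (hR : IsDiag R) (s : ℕ+) :
    IsDiag (T A s * R * star (T A s)) := by
  classical
  obtain ⟨r, hr⟩ := hR
  refine ⟨fun y => if y.1 0 = s then r y.tail else 0, fun v y => ?_⟩
  rw [mul_apply_eq_comp, mul_apply_eq_comp, T_apply]
  by_cases h : y.1 0 = s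
  · simp only [if_pos h]
    rw [hr, T_star_apply, dif_pos (tail_edge y s h), cons_tail y s h]
  · simp only [if_neg h, zero_mul]

theorem Q_apply (s : ℕ+) (v : Hil A) (x : MarkovShift A) :
    Q A s v x = if A s (x.1 0) = 1 then v x else 0 := by
  classical
  rw [Q, mul_apply_eq_comp, T_star_apply]
  split_ifs with h
  · have h0 : (cons s x h).1 0 = s := rfl
    rw [T_apply, if_pos h0, tail_cons]
  · rfl

theorem isDiag_Q (s : ℕ+) : IsDiag (Q A s) := by
  classical
  refine ⟨fun x => if A s (x.1 0) = 1 then 1 else 0, fun v x => ?_⟩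
  rw [Q_apply]
  by_cases h : A s (x.1 0) = 1
  · simp only [if_pos h, one_mul]
  · simp only [if_neg h, zero_mul]

theorem isDiag_Qprod (F : List ℕ+) : IsDiag (Qprod A F) := by
  induction F with
  | nil => simpa [Qprod] using isDiag_one
  | cons i F ih =>
    have : Qprod A (i :: F) = Q A i * Qprod A F := by simp [Qprod]
    rw [this]
    exact (isDiag_Q i).mul ih

theorem generator_cons (s : ℕ+) (α F : List ℕ+) :
    Tword A (s :: α) * Qprod A F * star (Tword A (s :: α)) =
      T A s * (Tword A α * Qprod A F * star (Tword A α)) * star (T A s) := by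
  simp [Tword, mul_assoc]

theorem generator_nil (F : List ℕ+) :
    Tword A [] * Qprod A F * star (Tword A []) = Qprod A F := by
  simp [Tword]

theorem isDiag_generator (α F : List ℕ+) :
    IsDiag (Tword A α * Qprod A F * star (Tword A α)) := by
  induction α with
  | nil => rw [generator_nil]; exact isDiag_Qprod F
  | cons s α ih => rw [generator_cons]; exact ih.conj s

theorem IsDiag.of_mem {R : Hil A →L[ℂ] Hil A} (h : R ∈ diagGenerators A) : IsDiag R := by
  obtain ⟨α, F, rfl⟩ := h
  exact isDiag_generator α F

theorem star_Q (s : ℕ+) : star (Q A s) = Q A s := by simp [Q]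

theorem star_Qprod (F : List ℕ+) : star (Qprod A F) = Qprod A F := by
  induction F with
  | nil => simp [Qprod]
  | cons i F ih =>
    have : Qprod A (i :: F) = Q A i * Qprod A F := by simp [Qprod]
    rw [this, star_mul, ih, star_Q]
    exact (isDiag_Qprod F).comm (isDiag_Q i)

theorem star_generator {R : Hil A →L[ℂ] Hil A} (h : R ∈ diagGenerators A) : star R = R := by
  obtain ⟨α, F, rfl⟩ := h
  simp [star_Qprod, mul_assoc]

theorem Q_mul_T (i s : ℕ+) : Q A i * T A s = T A s ∨ Q A i * T A s = 0 := by
  classical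
  by_cases h : A i s = 1
  · left
    ext v y
    rw [mul_apply_eq_comp, Q_apply, T_apply]
    by_cases hy : y.1 0 = s <;> simp [hy, h]
  · right
    ext v y
    rw [mul_apply_eq_comp, Q_apply, T_apply]
    by_cases hy : y.1 0 = s <;> simp [hy, h]

theorem Qprod_mul_T (F : List ℕ+) (s : ℕ+) :
    Qprod A F * T A s = T A s ∨ Qprod A F * T A s = 0 := by
  induction F with
  | nil => left; simp [Qprod]
  | cons i F ih =>
    have : Qprod A (i :: F) = Q A i * Qprod A F := by simp [Qprod]
    rw [this, mul_assoc]
    rcases ih with h | h <;> rw [h]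
    · exact Q_mul_T i s
    · right; simp

theorem T_star_mul_T {s t : ℕ+} (h : s ≠ t) : star (T A s) * T A t = 0 := by
  classical
  ext v x
  rw [mul_apply_eq_comp, T_star_apply]
  split_ifs with hx
  · rw [T_apply]
    have : (cons s x hx).1 0 = s := rfl
    rw [this, if_neg h]; rfl
  · rfl

theorem T_mul_Q (s : ℕ+) : T A s * Q A s = T A s := by
  classical
  ext v y
  rw [mul_apply_eq_comp, T_apply, T_apply]
  split_ifs with h
  · rw [Q_apply, if_pos (tail_edge y s h)]
  · rfl

theorem conj_mul (s : ℕ+) {X Y : Hil A →L[ℂ] Hil A} (hX : X * Q A s = Q A s * X) :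
    (T A s * X * star (T A s)) * (T A s * Y * star (T A s)) =
      T A s * (X * Y) * star (T A s) := by
  calc _ = T A s * (X * Q A s) * Y * star (T A s) := by simp only [Q, mul_assoc]
    _ = (T A s * Q A s) * (X * Y) * star (T A s) := by rw [hX]; simp only [mul_assoc]
    _ = _ := by rw [T_mul_Q]

theorem generator_mul (α F β G : List ℕ+) :
    (Tword A α * Qprod A F * star (Tword A α)) * (Tword A β * Qprod A G * star (Tword A β)) ∈
      insert 0 (diagGenerators A) := by
  induction α generalizing β with
  | nil =>
    rw [generator_nil]
    cases β with
    | nil =>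
      rw [generator_nil]
      right
      exact ⟨[], F ++ G, by rw [generator_nil]; simp [Qprod]⟩
    | cons t β =>
      have h : Qprod A F * (Tword A (t :: β) * Qprod A G * star (Tword A (t :: β))) =
          (Qprod A F * T A t) * (Tword A β * Qprod A G * star (Tword A β)) * star (T A t) := by
        rw [generator_cons]; simp only [mul_assoc]
      rw [h]
      rcases Qprod_mul_T (A := A) F t with h | h <;> rw [h]
      · right
        exact ⟨t :: β, G, (generator_cons t β G).symm⟩
      · left; simp
  | cons s α ih =>
    cases β with
    | nil =>
      rw [(isDiag_generator (s :: α) F).comm (isDiag_generator [] G), generator_nil,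
        generator_cons, ← mul_assoc, ← mul_assoc]
      rcases Qprod_mul_T (A := A) G s with h | h <;> rw [h]
      · right
        exact ⟨s :: α, F, (generator_cons s α F).symm⟩
      · left; simp
    | cons t β =>
      rw [generator_cons, generator_cons]
      by_cases hst : s = t
      · subst hst
        rw [conj_mul s ((isDiag_generator α F).comm (isDiag_Q s))]
        rcases ih β with h | ⟨γ, K, h⟩
        · left; rw [h]; simp
        · right
          exact ⟨s :: γ, K, by rw [h, generator_cons]⟩
      · left
        have := T_star_mul_T (A := A) hst
        calc _ = T A s * (Tword A α * Qprod A F * star (Tword A α)) * (star (T A s) * T A t) *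
              (Tword A β * Qprod A G * star (Tword A β)) * star (T A t) := by
                simp only [mul_assoc]
          _ = 0 := by rw [this]; simp

/-- The linear span of the operators `T_α (∏_{i ∈ F} Q_i) T_α^*`; it is a unital `*`-algebra. -/
def diagSpan (A : Matrix ℕ+ ℕ+ ℕ) : StarSubalgebra ℂ (Hil A →L[ℂ] Hil A) where
  __ := (Submodule.span ℂ (diagGenerators A)).toSubalgebra
    (Submodule.subset_span ⟨[], [], by simp [Tword, Qprod]⟩) (by
      intro x y hx hy
      have h := Submodule.mul_mem_mul hx hy
      rw [Submodule.span_mul_span] at h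
      refine Submodule.span_le.mpr ?_ h
      rintro _ ⟨_, ⟨α, F, rfl⟩, _, ⟨β, G, rfl⟩, rfl⟩
      rcases generator_mul (A := A) α F β G with h | h
      · simp only [h]; exact Submodule.zero_mem _
      · exact Submodule.subset_span h)
  star_mem' := by
    intro x hx
    change x ∈ Submodule.span ℂ (diagGenerators A) at hx
    change star x ∈ Submodule.span ℂ (diagGenerators A)
    induction hx using Submodule.span_induction with
    | mem x h => rw [star_generator h]; exact Submodule.subset_span h
    | zero => simp
    | add x y _ _ hx hy => rw [star_add]; exact Submodule.add_mem _ hx hy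
    | smul c x _ hx => rw [star_smul]; exact Submodule.smul_mem _ _ hx

/-- The unital commutative `C^*`-algebra
`closure (span {T_α (∏_{i ∈ F} Q_i) T_α^* : α a finite word, F finite})` of operators on
`ℓ²(Σ_A)`. -/
def diagAlgebra (A : Matrix ℕ+ ℕ+ ℕ) : StarSubalgebra ℂ (Hil A →L[ℂ] Hil A) :=
  (diagSpan A).topologicalClosure

theorem coe_diagAlgebra : (diagAlgebra A : Set (Hil A →L[ℂ] Hil A)) =
    closure (Submodule.span ℂ (diagGenerators A) : Set (Hil A →L[ℂ] Hil A)) := rfl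

theorem generator_mem {R : Hil A →L[ℂ] Hil A} (h : R ∈ diagGenerators A) : R ∈ diagAlgebra A :=
  subset_closure (Submodule.subset_span h)

theorem diagAlgebra_induction {p : (Hil A →L[ℂ] Hil A) → Prop}
    (gen : ∀ R ∈ diagGenerators A, p R) (zero : p 0) (add : ∀ R S, p R → p S → p (R + S))
    (smul : ∀ (c : ℂ) R, p R → p (c • R)) (closed : IsClosed {R | p R})
    {R : Hil A →L[ℂ] Hil A} (hR : R ∈ diagAlgebra A) : p R := by
  have hR' : R ∈ closure (Submodule.span ℂ (diagGenerators A) : Set (Hil A →L[ℂ] Hil A)) := hR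
  refine closure_minimal (t := {R | p R}) ?_ closed hR'
  intro S hS
  induction hS using Submodule.span_induction with
  | mem x h => exact gen x h
  | zero => exact zero
  | add x y _ _ hx hy => exact add _ _ hx hy
  | smul c x _ hx => exact smul c _ hx

theorem diagAlgebra_comm {R S : Hil A →L[ℂ] Hil A} (hR : R ∈ diagAlgebra A)
    (hS : IsDiag S) : R * S = S * R := by
  refine diagAlgebra_induction (p := fun R => R * S = S * R) ?_ (by simp) ?_ ?_ ?_ hR
  · intro R h; exact (IsDiag.of_mem h).comm hS
  · intro R S h h'; rw [add_mul, mul_add, h, h']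
  · intro c R h; rw [smul_mul_assoc, mul_smul_comm, h]
  · exact isClosed_eq (by fun_prop) (by fun_prop)

theorem Q_mem (s : ℕ+) : Q A s ∈ diagAlgebra A :=
  generator_mem ⟨[], [s], by rw [generator_nil]; simp [Qprod]⟩

theorem conj_mem (s : ℕ+) {R : Hil A →L[ℂ] Hil A} (hR : R ∈ diagAlgebra A) :
    T A s * R * star (T A s) ∈ diagAlgebra A := by
  refine diagAlgebra_induction (p := fun R => T A s * R * star (T A s) ∈ diagAlgebra A)
    ?_ (by simp) ?_ ?_ ?_ hR
  · rintro R ⟨α, F, rfl⟩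
    exact generator_mem ⟨s :: α, F, (generator_cons s α F).symm⟩
  · intro R S h h'; rw [mul_add, add_mul]; exact add_mem h h'
  · intro c R h; rw [mul_smul_comm, smul_mul_assoc]; exact SMulMemClass.smul_mem c h
  · have : IsClosed (diagAlgebra A : Set (Hil A →L[ℂ] Hil A)) := isClosed_closure
    exact this.preimage (f := fun R => T A s * R * star (T A s)) (by fun_prop)

theorem conj_star_mem (s : ℕ+) {R : Hil A →L[ℂ] Hil A} (hR : R ∈ diagAlgebra A) :
    star (T A s) * R * T A s ∈ diagAlgebra A := by
  refine diagAlgebra_induction (p := fun R => star (T A s) * R * T A s ∈ diagAlgebra A)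
    ?_ (by simp) ?_ ?_ ?_ hR
  · rintro R ⟨α, F, rfl⟩
    cases α with
    | nil =>
      rw [generator_nil, mul_assoc]
      rcases Qprod_mul_T (A := A) F s with h | h <;> rw [h]
      · exact Q_mem s
      · simp
    | cons t α =>
      rw [generator_cons]
      have h : star (T A s) * (T A t * (Tword A α * Qprod A F * star (Tword A α)) *
          star (T A t)) * T A s = (star (T A s) * T A t) *
          (Tword A α * Qprod A F * star (Tword A α)) * (star (T A t) * T A s) := by
        simp only [mul_assoc]
      rw [h]
      by_cases hst : s = t
      · subst hst
        exact mul_mem (mul_mem (Q_mem s) (generator_mem ⟨α, F, rfl⟩)) (Q_mem s)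
      · rw [T_star_mul_T hst]; simp
  · intro R S h h'; rw [mul_add, add_mul]; exact add_mem h h'
  · intro c R h; rw [mul_smul_comm, smul_mul_assoc]; exact SMulMemClass.smul_mem c h
  · have : IsClosed (diagAlgebra A : Set (Hil A →L[ℂ] Hil A)) := isClosed_closure
    exact this.preimage (f := fun R => star (T A s) * R * T A s) (by fun_prop)

/-- The product `T_{x₁} ⋯ T_{x_n}` along a word in the letters and their inverses, where
`(s, true)` stands for `s`, `(s, false)` for `s⁻¹`, and `T_{s⁻¹} = T_s^*`. -/
def pathOp (A : Matrix ℕ+ ℕ+ ℕ) : List (ℕ+ × Bool) → (Hil A →L[ℂ] Hil A)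
  | [] => 1
  | (s, true) :: L => T A s * pathOp A L
  | (s, false) :: L => star (T A s) * pathOp A L

/-- The projection `e_g = T_g T_g^*`, where `T_g` is the product along the reduced form of the
element `g` of the free group on the alphabet. -/
def eProj (A : Matrix ℕ+ ℕ+ ℕ) (g : FreeGroup ℕ+) : Hil A →L[ℂ] Hil A :=
  pathOp A g.toWord * star (pathOp A g.toWord)

theorem pathOp_mem (L : List (ℕ+ × Bool)) : pathOp A L * star (pathOp A L) ∈ diagAlgebra A := by
  induction L with
  | nil => simp [pathOp]
  | cons a L ih =>
    obtain ⟨s, b⟩ := a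
    cases b with
    | true =>
      have := conj_mem s ih
      simpa only [pathOp, star_mul, mul_assoc] using this
    | false =>
      have := conj_star_mem s ih
      simpa only [pathOp, star_mul, star_star, mul_assoc] using this

theorem eProj_mem (g : FreeGroup ℕ+) : eProj A g ∈ diagAlgebra A := pathOp_mem _

theorem eProj_of (s : ℕ+) : eProj A (FreeGroup.of s) = T A s * star (T A s) := by
  simp [eProj, FreeGroup.toWord_of, pathOp]

/-- The spectrum (space of characters with the weak-`*` topology) of `diagAlgebra A`. -/
abbrev Spec (A : Matrix ℕ+ ℕ+ ℕ) : Type := WeakDual.characterSpace ℂ (diagAlgebra A)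

/-- The Borel `σ`-algebra of the spectrum. -/
instance (A : Matrix ℕ+ ℕ+ ℕ) : MeasurableSpace (Spec A) := borel _

instance (A : Matrix ℕ+ ℕ+ ℕ) : BorelSpace (Spec A) := ⟨rfl⟩

theorem spec_one (φ : Spec A) : φ (1 : diagAlgebra A) = 1 := map_one φ

/-- The configuration `(φ(e_g))_g ∈ {0,1}^𝔽` of a character `φ`, indexed by the free group `𝔽` on
the alphabet. -/
def config (φ : Spec A) (g : FreeGroup ℕ+) : ℂ := φ ⟨eProj A g, eProj_mem g⟩

/-- The evaluation `φ_ω(R) = (R δ_ω, δ_ω)`. -/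
def evalAt (ω : MarkovShift A) : diagAlgebra A →L[ℂ] ℂ where
  toFun R := ⟪delta ω, (R : Hil A →L[ℂ] Hil A) (delta ω)⟫_ℂ
  map_add' R S := by simp
  map_smul' c R := by simp
  cont := by
    have : Continuous fun R : diagAlgebra A => (R : Hil A →L[ℂ] Hil A) (delta ω) :=
      (ContinuousLinearMap.apply ℂ (Hil A) (delta ω)).continuous.comp continuous_subtype_val
    exact continuous_const.inner this

theorem evalAt_apply (ω : MarkovShift A) (R : diagAlgebra A) :
    evalAt ω R = (R : Hil A →L[ℂ] Hil A) (delta ω) ω := inner_delta _ _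

theorem apply_delta {R : Hil A →L[ℂ] Hil A} (hR : R ∈ diagAlgebra A) (ω : MarkovShift A) :
    R (delta ω) = (R (delta ω) ω) • delta ω := by
  classical
  simp only [← inner_delta ω]
  refine diagAlgebra_induction
    (p := fun R => R (delta ω) = ⟪delta ω, R (delta ω)⟫_ℂ • delta ω) ?_ (by simp) ?_ ?_ ?_ hR
  · intro R h
    obtain ⟨r, hr⟩ := IsDiag.of_mem h
    ext y
    rw [inner_delta, hr, hr, lp.coeFn_smul, Pi.smul_apply, delta_apply, delta_apply]
    by_cases hy : y = ω
    · subst hy; simp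
    · simp [hy]
  · intro R S h h'
    rw [add_apply, inner_add_right, add_smul, ← h, ← h']
  · intro c R h
    rw [smul_apply, inner_smul_right, mul_smul, ← h]
  · have h : Continuous fun R : Hil A →L[ℂ] Hil A => R (delta ω) :=
      (ContinuousLinearMap.apply ℂ (Hil A) (delta ω)).continuous
    have h' : Continuous fun R : Hil A →L[ℂ] Hil A => ⟪delta ω, R (delta ω)⟫_ℂ :=
      continuous_const.inner h
    exact isClosed_eq h (Continuous.smul (f := fun R : Hil A →L[ℂ] Hil A =>
      ⟪delta ω, R (delta ω)⟫_ℂ) (g := fun _ => delta ω) h' continuous_const)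

/-- The inclusion `ω ↦ φ_ω` of `Σ_A` into the spectrum. -/
def incl (ω : MarkovShift A) : Spec A :=
  ⟨StrongDual.toWeakDual (evalAt ω), by
    classical
    constructor
    · intro h
      have h1 : evalAt ω (1 : diagAlgebra A) = 0 := DFunLike.congr_fun h (1 : diagAlgebra A)
      rw [evalAt_apply] at h1
      simp [delta_apply] at h1
    · intro R S
      change evalAt ω (R * S) = evalAt ω R * evalAt ω S
      simp only [evalAt_apply]
      change (R : Hil A →L[ℂ] Hil A) ((S : Hil A →L[ℂ] Hil A) (delta ω)) ω = _
      rw [apply_delta S.2 ω, map_smul, lp.coeFn_smul, Pi.smul_apply, smul_eq_mul, mul_comm]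
      simp [delta_apply]⟩

theorem incl_apply (ω : MarkovShift A) (R : diagAlgebra A) :
    incl ω R = ⟪delta ω, (R : Hil A →L[ℂ] Hil A) (delta ω)⟫_ℂ := rfl

/-- The copy of `Σ_A` in the spectrum. -/
def shiftPoints (A : Matrix ℕ+ ℕ+ ℕ) : Set (Spec A) := Set.range (incl (A := A))

/-- The domain of the shift map: the points whose stem (the longest positive word filled in the
configuration) is not empty, that is, for which some letter is filled. -/
def shiftDomain (A : Matrix ℕ+ ℕ+ ℕ) : Set (Spec A) :=
  {φ | ∃ s : ℕ+, config φ (FreeGroup.of s) = 1}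

theorem isOpen_shiftDomain : IsOpen (shiftDomain A) := by
  have h : shiftDomain A = ⋃ s : ℕ+, {φ : Spec A | config φ (FreeGroup.of s) ≠ 0} := by
    ext φ
    simp only [shiftDomain, Set.mem_setOf_eq, Set.mem_iUnion]
    refine exists_congr fun s => ⟨fun h => by rw [h]; exact one_ne_zero, fun h => ?_⟩
    have h2 : config φ (FreeGroup.of s) * config φ (FreeGroup.of s) =
        config φ (FreeGroup.of s) := by
      unfold config
      rw [← map_mul]
      congr 1
      apply Subtype.ext
      change eProj A _ * eProj A _ = eProj A _
      have h3 := congrArg (· * star (T A s)) (T_mul_Q (A := A) s)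
      simp only [Q, mul_assoc] at h3
      rw [eProj_of, mul_assoc, h3]
    exact mul_right_cancel₀ h (by rw [h2, one_mul])
  rw [h]
  refine isOpen_iUnion fun s => ?_
  have hc : Continuous fun φ : Spec A => config φ (FreeGroup.of s) :=
    (WeakDual.eval_continuous _).comp continuous_subtype_val
  exact isOpen_ne_fun hc continuous_const

/-- The first letter `ω₀` of the stem, i.e. the unique letter filled in the configuration. -/
def firstLetter (φ : shiftDomain A) : ℕ+ := φ.2.choose

theorem config_firstLetter (φ : shiftDomain A) :
    config φ.1 (FreeGroup.of (firstLetter φ)) = 1 := φ.2.choose_spec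

theorem eq_firstLetter (φ : shiftDomain A) (s : ℕ+)
    (h : config φ.1 (FreeGroup.of s) = 1) : s = firstLetter φ := by
  by_contra hne
  have h1 := config_firstLetter φ
  have h2 : config φ.1 (FreeGroup.of s) * config φ.1 (FreeGroup.of (firstLetter φ)) = 0 := by
    unfold config
    rw [← map_mul]
    convert map_zero φ.1 using 2
    apply Subtype.ext
    change eProj A _ * eProj A _ = 0
    rw [eProj_of, eProj_of, mul_assoc, ← mul_assoc (star (T A s)), T_star_mul_T hne]
    simp
  rw [h, h1] at h2
  simp at h2

/-- The map `R ↦ T_s R T_s^*` of `diagAlgebra A`. -/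
def conjMap (A : Matrix ℕ+ ℕ+ ℕ) (s : ℕ+) : diagAlgebra A →L[ℂ] diagAlgebra A where
  toFun R := ⟨T A s * R * star (T A s), conj_mem s R.2⟩
  map_add' R S := by apply Subtype.ext; simp [mul_add, add_mul]
  map_smul' c R := by apply Subtype.ext; simp
  cont := by
    refine Continuous.subtype_mk ?_ _
    exact (continuous_const.mul continuous_subtype_val).mul continuous_const

/-- The shift map `σ` on `shiftDomain A`. It removes the first letter `ω₀` of the stem: in terms of
configurations `σ(ξ)_g = ξ_{ω₀ g}` (see `config_shiftMap`). -/
def shiftMap (φ : shiftDomain A) : Spec A :=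
  ⟨StrongDual.toWeakDual
      ((WeakDual.toStrongDual φ.1.1).comp (conjMap A (firstLetter φ))), by
    constructor
    · intro h
      have h1 : φ.1 (conjMap A (firstLetter φ) 1) = 0 :=
        DFunLike.congr_fun h (1 : diagAlgebra A)
      have h2 := config_firstLetter φ
      unfold config at h2
      have h3 : conjMap A (firstLetter φ) 1 =
          ⟨eProj A (FreeGroup.of (firstLetter φ)), eProj_mem _⟩ := by
        apply Subtype.ext
        change T A _ * 1 * star (T A _) = eProj A _
        rw [eProj_of, mul_one]
      rw [h3, h2] at h1
      exact one_ne_zero h1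
    · intro R S
      change φ.1 (conjMap A (firstLetter φ) (R * S)) =
        φ.1 (conjMap A (firstLetter φ) R) * φ.1 (conjMap A (firstLetter φ) S)
      rw [← map_mul]
      congr 1
      apply Subtype.ext
      exact (conj_mul _ (diagAlgebra_comm R.2 (isDiag_Q _))).symm⟩

theorem shiftMap_apply (φ : shiftDomain A) (R : diagAlgebra A) :
    shiftMap φ R = φ.1 ⟨T A (firstLetter φ) * R * star (T A (firstLetter φ)),
      conj_mem _ R.2⟩ := rfl

theorem config_shiftMap (φ : shiftDomain A) (g : FreeGroup ℕ+) :
    config (shiftMap φ) g = config φ.1 (FreeGroup.of (firstLetter φ) * g) := by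
  set s := firstLetter φ with hs
  have h1 : config φ.1 (FreeGroup.of s) = 1 := config_firstLetter φ
  unfold config at *
  rw [shiftMap_apply]
  by_cases hg : ∃ L, g.toWord = (s, false) :: L
  · obtain ⟨L, hL⟩ := hg
    have hred : FreeGroup.IsReduced ((s, false) :: L) := hL ▸ FreeGroup.isReduced_toWord
    have hL' : FreeGroup.IsReduced L := by
      exact hred.infix ⟨[(s, false)], [], by simp⟩
    have hgL : FreeGroup.of s * g = FreeGroup.mk L := by
      rw [← FreeGroup.mk_toWord (x := g), hL]
      have : (FreeGroup.mk ((s, false) :: L) : FreeGroup ℕ+) =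
          (FreeGroup.of s)⁻¹ * FreeGroup.mk L := by
        simp [FreeGroup.of, FreeGroup.inv_mk, FreeGroup.invRev, FreeGroup.mul_mk]
      rw [this, mul_inv_cancel_left]
    have hw : (FreeGroup.of s * g).toWord = L := by
      rw [hgL, FreeGroup.toWord_mk, hL'.reduce_eq]
    have key : (⟨T A s * eProj A g * star (T A s), conj_mem s (eProj_mem g)⟩ : diagAlgebra A) =
        ⟨eProj A (FreeGroup.of s), eProj_mem _⟩ * ⟨eProj A (FreeGroup.of s * g), eProj_mem _⟩ *
        ⟨eProj A (FreeGroup.of s), eProj_mem _⟩ := by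
      apply Subtype.ext
      change T A s * eProj A g * star (T A s) =
        eProj A (FreeGroup.of s) * eProj A (FreeGroup.of s * g) * eProj A (FreeGroup.of s)
      rw [eProj_of]
      unfold eProj
      rw [hw, hL]
      simp only [pathOp, star_mul, star_star, mul_assoc]
    rw [← hs] at *
    change φ.1 ⟨T A s * eProj A g * star (T A s), conj_mem s (eProj_mem g)⟩ = _
    rw [key, map_mul, map_mul, h1, one_mul, mul_one]
  · have hw : (FreeGroup.of s * g).toWord = (s, true) :: g.toWord := by
      have : FreeGroup.of s * g = FreeGroup.mk ((s, true) :: g.toWord) := by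
        conv_lhs => rw [← FreeGroup.mk_toWord (x := g)]
        simp [FreeGroup.of, FreeGroup.mul_mk]
      rw [this, FreeGroup.toWord_mk]
      refine FreeGroup.IsReduced.reduce_eq ?_
      cases hgw : g.toWord with
      | nil => simp
      | cons a L =>
        have hr : FreeGroup.IsReduced (a :: L) := hgw ▸ FreeGroup.isReduced_toWord
        rw [FreeGroup.isReduced_cons_cons]
        refine ⟨?_, hr⟩
        intro ha
        obtain ⟨t, b⟩ := a
        cases b with
        | true => rfl
        | false =>
          exfalso
          simp only at ha
          subst ha
          exact hg ⟨L, hgw⟩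
    congr 1
    apply Subtype.ext
    change T A (firstLetter φ) * eProj A g * star (T A (firstLetter φ)) = eProj A _
    rw [← hs]
    unfold eProj
    rw [hw]
    simp only [pathOp, star_mul, mul_assoc]

/-- Conformality in the sense of Denker and Urbański: `μ(σ(E)) = ∫_E D dμ` for every special set,
i.e. every measurable `E ⊆ U` on which `σ : U → X` is injective. The measure used on the
measurable set `U` is the restriction of `μ`. -/
def IsConformal {X : Type*} [MeasurableSpace X] {U : Set X} (σ : U → X) (D : U → ℝ≥0)
    (μ : MeasureTheory.Measure X) : Prop :=
  ∀ E : Set U, MeasurableSet (Subtype.val '' E) → Set.InjOn σ E →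
    μ (σ '' E) = ∫⁻ x in E, (D x : ℝ≥0∞) ∂(μ.comap Subtype.val)

/-- The transition matrix of the renewal shift: `A(1, n) = A(n + 1, n) = 1`, all other entries
are `0`. -/
def renewal : Matrix ℕ+ ℕ+ ℕ := fun i j => if i = 1 ∨ i = j + 1 then 1 else 0

/-- Since `Q_1 = 1` for the renewal shift, the algebra `O_A` is unital, so its diagonal subalgebra
`D_A` is the unital algebra `diagAlgebra renewal`. -/
theorem Q_renewal_one : Q renewal 1 = 1 := by
  classical
  ext v x
  rw [Q_apply, if_pos (by simp [renewal])]
  rfl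

/-- The Exel-Laca space `X_A` of the renewal shift. -/
abbrev XA : Type := Spec renewal

end ExelLaca

end

open scoped ENNReal NNReal InnerProductSpace

noncomputable section

namespace ExelLaca
open MarkovShift Filter Topology MeasureTheory

/-! ### Characters of the diagonal algebra, the shift and its inverse branches, for a general matrix
`A`. -/

section Markov
variable {A : Matrix ℕ+ ℕ+ ℕ}

/-! Off `Σ_A`, the space `X_A` is the backward orbit of `ξ⁰` under the shift, and this orbit is a
countable tree. A character `φ` has a preimage with first letter `s` exactly when `φ(Q_s) = 1`, and
this preimage is unique (`shiftMap_sourceProj`, `shiftMap_branch`, `eq_of_shiftMap_eq`). For the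
renewal matrix `Q_1 = 1` and `Q_{n+1} = T_n T_n^*`, so `ξ⁰` has the single preimage with letter `1`,
while a point with first letter `n` has two, with letters `1` and `n + 1`. The points that reach
`ξ⁰` are thus indexed by binary strings, with `2^n` of them at depth `n + 1` (`stemPoint`). A
character that never reaches `ξ⁰` can be shifted forever, and its sequence of first letters
identifies it with a point of `Σ_A` (`mem_shiftPoints_of_orbit`, `compl_range_finitePoint`).

A measure null on `Σ_A` is therefore atomic on the tree, and conformality becomes the pointwise
relation `μ{σ x} = D(x) μ{x}` (`isConformal_iff_of_countable`). Read backwards, it gives each atom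
as `μ{ξ⁰}` times the product of the `D⁻¹` along the path to `ξ⁰` (`measure_finitePoint`). Hence a
conformal probability measure null on `Σ_A` exists if and only if the total weight is finite, and it
is then unique.

With `D = e^{βf}`, each `D⁻¹` lies between `e^{-β‖f‖}` and `e^{-βM}`. Comparison with `∑ 2^n
r^{n+1}`, a geometric series of ratio `2r` (`tsum_pow_length`), gives finiteness for `βM > log 2`
and divergence for `β‖f‖ < log 2`. -/

theorem isClosed_diagAlgebra : IsClosed (diagAlgebra A : Set (Hil A →L[ℂ] Hil A)) :=
  isClosed_closure

instance : CompleteSpace (diagAlgebra A) := isClosed_diagAlgebra.completeSpace_coe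

/-- The generators span a dense subspace and characters are linear and continuous. -/
theorem spec_ext {φ ψ : Spec A}
    (h : ∀ R (hR : R ∈ diagGenerators A), φ ⟨R, generator_mem hR⟩ = ψ ⟨R, generator_mem hR⟩) :
    φ = ψ := by
  refine DFunLike.ext _ _ fun R => ?_
  -- `diagAlgebra_induction` speaks of operators on the whole Hilbert space, so membership has to be
  -- carried inside the predicate.
  have key : ∃ hR : R.1 ∈ diagAlgebra A, φ ⟨R.1, hR⟩ = ψ ⟨R.1, hR⟩ := by
    refine diagAlgebra_induction (p := fun R => ∃ hR : R ∈ diagAlgebra A, φ ⟨R, hR⟩ = ψ ⟨R, hR⟩)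
      (fun R hR => ⟨generator_mem hR, h R hR⟩) ⟨zero_mem _, ?_⟩ ?_ ?_ ?_ R.2
    · exact (map_zero φ).trans (map_zero ψ).symm
    · rintro R S ⟨hR, h1⟩ ⟨hS, h2⟩
      refine ⟨add_mem hR hS, ?_⟩
      have := congrArg₂ (· + ·) h1 h2
      simp only [← map_add] at this
      exact this
    · rintro c R ⟨hR, h1⟩
      refine ⟨SMulMemClass.smul_mem c hR, ?_⟩
      have := congrArg (c • ·) h1
      simp only [← map_smul] at this
      exact this
    · have hc : IsClosed {R : diagAlgebra A | φ R = ψ R} :=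
        isClosed_eq (map_continuous φ) (map_continuous ψ)
      convert isClosed_diagAlgebra.isClosedEmbedding_subtypeVal.isClosedMap _ hc using 1
      ext R
      constructor
      · rintro ⟨hR, h1⟩; exact ⟨⟨R, hR⟩, h1, rfl⟩
      · rintro ⟨R, h1, rfl⟩; exact ⟨R.2, h1⟩
  exact key.2

/-- The range projection `T_s T_s^*` as an element of `diagAlgebra A`. -/
def letterProj (A : Matrix ℕ+ ℕ+ ℕ) (s : ℕ+) : diagAlgebra A := conjMap A s 1

/-- The source projection `Q_s` as an element of `diagAlgebra A`. -/
def sourceProj (A : Matrix ℕ+ ℕ+ ℕ) (s : ℕ+) : diagAlgebra A := ⟨Q A s, Q_mem s⟩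

theorem coe_letterProj (s : ℕ+) :
    (letterProj A s : Hil A →L[ℂ] Hil A) = T A s * star (T A s) := by
  change T A s * 1 * star (T A s) = _
  rw [mul_one]

theorem isDiag_letterProj (s : ℕ+) : IsDiag (letterProj A s : Hil A →L[ℂ] Hil A) :=
  isDiag_one.conj s

theorem config_of (φ : Spec A) (s : ℕ+) : config φ (FreeGroup.of s) = φ (letterProj A s) := by
  unfold config
  exact congrArg φ (Subtype.ext ((eProj_of s).trans (coe_letterProj s).symm))

theorem conjMap_mul (s : ℕ+) (R S : diagAlgebra A) :
    conjMap A s R * conjMap A s S = conjMap A s (R * S) :=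
  Subtype.ext (conj_mul s (diagAlgebra_comm R.2 (isDiag_Q s)))

theorem letterProj_mul_conjMap (s : ℕ+) (R : diagAlgebra A) :
    letterProj A s * conjMap A s R = conjMap A s R := by
  rw [letterProj, conjMap_mul, one_mul]

theorem letterProj_mul_self (s : ℕ+) : letterProj A s * letterProj A s = letterProj A s :=
  letterProj_mul_conjMap s 1

/-- `T_s R T_s^*` lies under the range projection of `T_s`, so it vanishes at `φ` unless `s` is the
first letter. -/
theorem apply_conjMap (φ : Spec A) (s : ℕ+) (R : diagAlgebra A) :
    φ (conjMap A s R) = φ (letterProj A s) * φ (conjMap A s R) := by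
  rw [← map_mul, letterProj_mul_conjMap]

theorem apply_letterProj (φ : Spec A) (s : ℕ+) :
    φ (letterProj A s) = 0 ∨ φ (letterProj A s) = 1 := by
  have h : φ (letterProj A s) * φ (letterProj A s) = φ (letterProj A s) := by
    rw [← map_mul, letterProj_mul_self]
  exact IsIdempotentElem.iff_eq_zero_or_one.mp h

theorem mem_shiftDomain {φ : Spec A} {s : ℕ+} (h : φ (letterProj A s) = 1) :
    φ ∈ shiftDomain A := ⟨s, (config_of φ s).trans h⟩

theorem notMem_shiftDomain {φ : Spec A} : φ ∉ shiftDomain A ↔ ∀ s, φ (letterProj A s) = 0 := by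
  simp only [shiftDomain, Set.mem_ofPred_eq, not_exists, config_of]
  refine forall_congr' fun s => ⟨fun h => (apply_letterProj φ s).resolve_right h, fun h => ?_⟩
  rw [h]; exact zero_ne_one

theorem apply_letterProj_firstLetter (φ : shiftDomain A) :
    φ.1 (letterProj A (firstLetter φ)) = 1 := (config_of _ _).symm.trans (config_firstLetter φ)

theorem firstLetter_eq (φ : shiftDomain A) {s : ℕ+} (h : φ.1 (letterProj A s) = 1) :
    firstLetter φ = s := (eq_firstLetter φ s ((config_of _ _).trans h)).symm

theorem apply_letterProj_of_ne (φ : shiftDomain A) {s : ℕ+} (h : s ≠ firstLetter φ) :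
    φ.1 (letterProj A s) = 0 :=
  (apply_letterProj φ.1 s).resolve_right fun h1 => h (firstLetter_eq φ h1).symm

theorem shiftMap_apply_conjMap (φ : shiftDomain A) (R : diagAlgebra A) :
    shiftMap φ R = φ.1 (conjMap A (firstLetter φ) R) := rfl

theorem conjMap_sourceProj (s : ℕ+) : conjMap A s (sourceProj A s) = letterProj A s := by
  apply Subtype.ext
  rw [coe_letterProj]
  change T A s * Q A s * star (T A s) = _
  rw [T_mul_Q]

/-- Admissibility of the removed letter: this is the hypothesis that `branch` needs to put it back.
-/
theorem shiftMap_sourceProj (φ : shiftDomain A) :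
    shiftMap φ (sourceProj A (firstLetter φ)) = 1 := by
  rw [shiftMap_apply_conjMap, conjMap_sourceProj, apply_letterProj_firstLetter]

/-- The map `R ↦ T_s^* R T_s` of `diagAlgebra A`. -/
def conjStarMap (A : Matrix ℕ+ ℕ+ ℕ) (s : ℕ+) : diagAlgebra A →L[ℂ] diagAlgebra A where
  toFun R := ⟨star (T A s) * R * T A s, conj_star_mem s R.2⟩
  map_add' R S := by apply Subtype.ext; simp [mul_add, add_mul]
  map_smul' c R := by apply Subtype.ext; simp
  cont := by
    refine Continuous.subtype_mk ?_ _
    exact (continuous_const.mul continuous_subtype_val).mul continuous_const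

theorem Q_mul_T_star (s : ℕ+) : Q A s * star (T A s) = star (T A s) := by
  have h := congrArg star (T_mul_Q (A := A) s)
  rwa [star_mul, star_Q] at h

theorem conjStarMap_one (s : ℕ+) : conjStarMap A s 1 = sourceProj A s := by
  apply Subtype.ext
  change star (T A s) * 1 * T A s = Q A s
  rw [mul_one, Q]

/-- `R` commutes with `T_s T_s^*`, which can be moved next to `T_s^*` and absorbed there. -/
theorem conjStarMap_mul (s : ℕ+) (R S : diagAlgebra A) :
    conjStarMap A s R * conjStarMap A s S = conjStarMap A s (R * S) := by
  apply Subtype.ext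
  change (star (T A s) * (R : Hil A →L[ℂ] Hil A) * T A s) *
    (star (T A s) * (S : Hil A →L[ℂ] Hil A) * T A s) =
    star (T A s) * ((R : Hil A →L[ℂ] Hil A) * (S : Hil A →L[ℂ] Hil A)) * T A s
  have h := diagAlgebra_comm R.2 (isDiag_letterProj (A := A) s)
  rw [coe_letterProj] at h
  calc _ = star (T A s) * ((R : Hil A →L[ℂ] Hil A) * (T A s * star (T A s))) *
        (S : Hil A →L[ℂ] Hil A) * T A s := by simp only [mul_assoc]
    _ = (Q A s * star (T A s)) * ((R : Hil A →L[ℂ] Hil A) * (S : Hil A →L[ℂ] Hil A)) * T A s := by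
        rw [h, Q]; simp only [mul_assoc]
    _ = _ := by rw [Q_mul_T_star]

theorem conjMap_conjStarMap (s : ℕ+) (R : diagAlgebra A) :
    conjMap A s (conjStarMap A s R) = letterProj A s * R * letterProj A s := by
  apply Subtype.ext
  change T A s * (star (T A s) * (R : Hil A →L[ℂ] Hil A) * T A s) * star (T A s) =
    (letterProj A s : Hil A →L[ℂ] Hil A) * R * letterProj A s
  rw [coe_letterProj]
  simp only [mul_assoc]

theorem conjStarMap_conjMap (s : ℕ+) (R : diagAlgebra A) :
    conjStarMap A s (conjMap A s R) = sourceProj A s * R * sourceProj A s := by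
  apply Subtype.ext
  change star (T A s) * (T A s * (R : Hil A →L[ℂ] Hil A) * star (T A s)) * T A s =
    Q A s * (R : Hil A →L[ℂ] Hil A) * Q A s
  simp only [Q, mul_assoc]

/-- The inverse branch of the shift at the letter `s`: the character `R ↦ φ(T_s^* R T_s)`. -/
def branch (s : ℕ+) (φ : Spec A) (h : φ (sourceProj A s) = 1) : Spec A :=
  ⟨StrongDual.toWeakDual ((WeakDual.toStrongDual φ.1).comp (conjStarMap A s)), by
    constructor
    · intro h0
      have h1 : φ (conjStarMap A s 1) = 0 := DFunLike.congr_fun h0 (1 : diagAlgebra A)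
      rw [conjStarMap_one, h] at h1
      exact one_ne_zero h1
    · intro R S
      change φ (conjStarMap A s (R * S)) = φ (conjStarMap A s R) * φ (conjStarMap A s S)
      rw [← map_mul, conjStarMap_mul]⟩

theorem branch_apply (s : ℕ+) (φ : Spec A) (h : φ (sourceProj A s) = 1) (R : diagAlgebra A) :
    branch s φ h R = φ (conjStarMap A s R) := rfl

theorem branch_letterProj (s : ℕ+) (φ : Spec A) (h : φ (sourceProj A s) = 1) :
    branch s φ h (letterProj A s) = 1 := by
  rw [branch_apply, letterProj, conjStarMap_conjMap, map_mul, map_mul, h, map_one]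
  simp

theorem branch_mem (s : ℕ+) (φ : Spec A) (h : φ (sourceProj A s) = 1) :
    branch s φ h ∈ shiftDomain A := mem_shiftDomain (branch_letterProj s φ h)

theorem firstLetter_branch (s : ℕ+) (φ : Spec A) (h : φ (sourceProj A s) = 1) :
    firstLetter ⟨branch s φ h, branch_mem s φ h⟩ = s :=
  firstLetter_eq _ (branch_letterProj s φ h)

theorem shiftMap_branch (s : ℕ+) (φ : Spec A) (h : φ (sourceProj A s) = 1) :
    shiftMap ⟨branch s φ h, branch_mem s φ h⟩ = φ := by
  refine DFunLike.ext _ _ fun R => ?_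
  rw [shiftMap_apply_conjMap, firstLetter_branch, branch_apply, conjStarMap_conjMap, map_mul,
    map_mul, h, one_mul, mul_one]

/-- The shift forgets only the first letter `s`: since `φ(T_s T_s^*) = 1`, the value `φ(R)` is
recovered as `σ(φ)(T_s^* R T_s)`. -/
theorem eq_of_shiftMap_eq {φ ψ : shiftDomain A} (h1 : firstLetter φ = firstLetter ψ)
    (h2 : shiftMap φ = shiftMap ψ) : φ = ψ := by
  have key : ∀ (χ : shiftDomain A) (R : diagAlgebra A),
      χ.1 R = shiftMap χ (conjStarMap A (firstLetter χ) R) := fun χ R => by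
    rw [shiftMap_apply_conjMap, conjMap_conjStarMap, map_mul, map_mul,
      apply_letterProj_firstLetter, one_mul, mul_one]
  refine Subtype.ext (DFunLike.ext _ _ fun R => ?_)
  rw [key φ, key ψ, h1, h2]

theorem Q_mul_T_eq (i s : ℕ+) : Q A i * T A s = if A i s = 1 then T A s else 0 := by
  classical
  ext v y
  rw [mul_apply_eq_comp, Q_apply]
  by_cases h : A i s = 1 <;> by_cases hy : y.1 0 = s <;> simp [T_apply, hy, h]

/-- `Q_i` either fixes or kills the range projection of the first letter, whose value at `φ` is `1`.
-/
theorem apply_sourceProj (φ : shiftDomain A) (i : ℕ+) :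
    φ.1 (sourceProj A i) = if A i (firstLetter φ) = 1 then 1 else 0 := by
  have h : sourceProj A i * letterProj A (firstLetter φ) =
      if A i (firstLetter φ) = 1 then letterProj A (firstLetter φ) else 0 := by
    apply Subtype.ext
    change Q A i * (letterProj A (firstLetter φ) : Hil A →L[ℂ] Hil A) = _
    rw [coe_letterProj, ← mul_assoc, Q_mul_T_eq]
    split_ifs
    · rw [coe_letterProj]
    · simp
  have h1 := congrArg φ.1 h
  rw [map_mul, apply_letterProj_firstLetter, mul_one] at h1
  rw [h1]
  split_ifs
  · exact apply_letterProj_firstLetter φ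
  · exact map_zero φ.1

theorem Qprod_mem (F : List ℕ+) : Qprod A F ∈ diagAlgebra A :=
  generator_mem ⟨[], F, (generator_nil F).symm⟩

theorem apply_Qprod (φ : Spec A) (F : List ℕ+) :
    φ ⟨Qprod A F, Qprod_mem F⟩ = (F.map fun i => φ (sourceProj A i)).prod := by
  induction F with
  | nil => exact (congrArg φ (Subtype.ext (by simp [Qprod]))).trans (map_one φ)
  | cons i F ih =>
    rw [List.map_cons, List.prod_cons, ← ih, ← map_mul]
    refine congrArg φ (Subtype.ext ?_)
    change Qprod A (i :: F) = Q A i * Qprod A F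
    simp [Qprod]

theorem apply_generator_nil_congr {φ ψ : Spec A}
    (h : ∀ i, φ (sourceProj A i) = ψ (sourceProj A i)) (F : List ℕ+) :
    φ ⟨_, generator_mem ⟨[], F, rfl⟩⟩ = ψ ⟨_, generator_mem ⟨[], F, rfl⟩⟩ := by
  have h1 : (⟨_, generator_mem ⟨[], F, rfl⟩⟩ : diagAlgebra A) = ⟨Qprod A F, Qprod_mem F⟩ :=
    Subtype.ext (generator_nil F)
  rw [h1, apply_Qprod, apply_Qprod]
  simp only [h]

theorem generator_cons_eq (s : ℕ+) (α F : List ℕ+) :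
    (⟨_, generator_mem ⟨s :: α, F, rfl⟩⟩ : diagAlgebra A) =
      conjMap A s ⟨_, generator_mem ⟨α, F, rfl⟩⟩ := Subtype.ext (generator_cons s α F)

/-- A character all of whose iterates under the shift are defined is determined by the sequence of
first letters of these iterates. -/
theorem eq_of_orbits_eq (Φ Ψ : ℕ → shiftDomain A)
    (hΦ : ∀ n, shiftMap (Φ n) = (Φ (n + 1)).1) (hΨ : ∀ n, shiftMap (Ψ n) = (Ψ (n + 1)).1)
    (h : ∀ n, firstLetter (Φ n) = firstLetter (Ψ n)) : (Φ 0).1 = (Ψ 0).1 := by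
  refine spec_ext ?_
  rintro _ ⟨α, F, rfl⟩
  -- Peeling a letter off `α` moves one step along the orbits, so the induction needs all `n` at
  -- once.
  suffices H : ∀ n, (Φ n).1 ⟨_, generator_mem ⟨α, F, rfl⟩⟩ =
      (Ψ n).1 ⟨_, generator_mem ⟨α, F, rfl⟩⟩ from H 0
  induction α with
  | nil =>
    exact fun n => apply_generator_nil_congr (fun i => by rw [apply_sourceProj, apply_sourceProj, h])
      F
  | cons s α ih =>
    intro n
    rw [generator_cons_eq]
    by_cases hs : s = firstLetter (Φ n)
    · have hs' := hs.trans (h n)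
      have h1 := shiftMap_apply_conjMap (Φ n) ⟨_, generator_mem ⟨α, F, rfl⟩⟩
      have h2 := shiftMap_apply_conjMap (Ψ n) ⟨_, generator_mem ⟨α, F, rfl⟩⟩
      rw [← hs] at h1
      rw [← hs'] at h2
      rw [← h1, ← h2, hΦ, hΨ]
      exact ih (n + 1)
    · rw [apply_conjMap, apply_conjMap (Ψ n).1, apply_letterProj_of_ne _ hs,
        apply_letterProj_of_ne _ (h n ▸ hs), zero_mul, zero_mul]

theorem incl_letterProj (ω : MarkovShift A) (s : ℕ+) :
    incl ω (letterProj A s) = if ω.1 0 = s then 1 else 0 := by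
  classical
  change evalAt ω (letterProj A s) = _
  rw [evalAt_apply, coe_letterProj, mul_apply_eq_comp, T_apply]
  by_cases h : ω.1 0 = s
  · rw [if_pos h, if_pos h, T_star_apply, dif_pos (tail_edge ω s h), cons_tail ω s h, delta_apply,
      if_pos rfl]
  · rw [if_neg h, if_neg h]

theorem incl_mem (ω : MarkovShift A) : incl ω ∈ shiftDomain A :=
  mem_shiftDomain (s := ω.1 0) (by rw [incl_letterProj, if_pos rfl])

theorem firstLetter_incl (ω : MarkovShift A) : firstLetter ⟨incl ω, incl_mem ω⟩ = ω.1 0 :=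
  firstLetter_eq _ (by rw [incl_letterProj, if_pos rfl])

theorem shiftMap_incl (ω : MarkovShift A) : shiftMap ⟨incl ω, incl_mem ω⟩ = incl ω.tail := by
  classical
  refine DFunLike.ext _ _ fun R => ?_
  rw [shiftMap_apply_conjMap, firstLetter_incl]
  change evalAt ω _ = evalAt ω.tail R
  rw [evalAt_apply, evalAt_apply]
  change (T A (ω.1 0) * (R : Hil A →L[ℂ] Hil A) * star (T A (ω.1 0))) (delta ω) ω = _
  have h : star (T A (ω.1 0)) (delta ω) = delta ω.tail := by
    ext x
    rw [T_star_apply, delta_apply]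
    split_ifs with h1 h2 h2
    · subst h2
      rw [cons_tail ω _ rfl, delta_apply, if_pos rfl]
    · rw [delta_apply, if_neg]
      exact fun h3 => h2 (congrArg tail h3)
    · subst h2
      exact absurd (tail_edge ω _ rfl) h1
    · rfl
  rw [mul_apply_eq_comp, mul_apply_eq_comp, h, T_apply, if_pos rfl]

/-- A character all of whose iterates under the shift are defined comes from `Σ_A`. -/
theorem mem_shiftPoints_of_orbit (Φ : ℕ → shiftDomain A)
    (hΦ : ∀ n, shiftMap (Φ n) = (Φ (n + 1)).1) : (Φ 0).1 ∈ shiftPoints A := by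
  -- The source projection of the letter just removed is `1` at the next iterate, which forces an
  -- allowed transition.
  have hA : ∀ n, A (firstLetter (Φ n)) (firstLetter (Φ (n + 1))) = 1 := fun n => by
    have h := shiftMap_sourceProj (Φ n)
    rw [hΦ, apply_sourceProj] at h
    by_contra h1
    rw [if_neg h1] at h
    exact zero_ne_one h
  let ω : ℕ → MarkovShift A := fun n => ⟨fun j => firstLetter (Φ (n + j)), fun j => hA (n + j)⟩
  have hω : ∀ n, (ω n).tail = ω (n + 1) := fun n => Subtype.ext (funext fun j => by
    change firstLetter (Φ (n + (j + 1))) = firstLetter (Φ (n + 1 + j))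
    rw [add_right_comm, add_assoc])
  refine ⟨ω 0, (eq_of_orbits_eq Φ (fun n => ⟨incl (ω n), incl_mem _⟩) hΦ (fun n => ?_)
    fun n => ?_).symm⟩
  · rw [shiftMap_incl, hω]
  · rw [firstLetter_incl]
    rfl

end Markov

/-! ### Measures concentrated on a countable set. -/

section Atomic
variable {X : Type*} [MeasurableSpace X] [MeasurableSingletonClass X] {Y : Set X} {μ : Measure X}

/-- `S` need not be measurable: up to a null set it is the countable set `S ∩ Y`. This is what
allows images `σ(E)` to be measured directly. -/
theorem measure_eq_tsum_of_countable (hY : Y.Countable) (h0 : μ Yᶜ = 0) (S : Set X) :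
    μ S = ∑' x : S, μ {x.1} := by
  have hs : (S ∩ Y).Countable := hY.mono Set.inter_subset_right
  have h1 : μ S = ∫⁻ _ in S ∩ Y, 1 ∂μ := by
    rw [setLIntegral_one, measure_inter_conull h0]
  rw [h1, lintegral_countable _ hs, tsum_subtype (S ∩ Y) fun x => 1 * μ {x},
    tsum_subtype S fun x => μ {x}]
  refine tsum_congr fun x => ?_
  by_cases hx : x ∈ S
  · by_cases hy : x ∈ Y
    · simp [hx, hy]
    · have : μ {x} = 0 := measure_mono_null (by simpa using hy) h0
      simp [hx, hy, this]
  · simp [hx]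

theorem setLIntegral_comap_eq_tsum {U : Set X} (hU : MeasurableSet U) (hY : Y.Countable)
    (h0 : μ Yᶜ = 0) (D : U → ℝ≥0∞) (E : Set U) :
    ∫⁻ x in E, D x ∂(μ.comap Subtype.val) = ∑' x : E, D x * μ {x.1.1} := by
  set ν := μ.comap (Subtype.val : U → X) with hν
  have hc : ∀ S : Set U, ν S = μ (Subtype.val '' S) := fun S =>
    (MeasurableEmbedding.subtype_coe hU).comap_apply _ _
  set Z : Set U := Subtype.val ⁻¹' Y with hZ
  have hZ0 : ν Zᶜ = 0 := by
    rw [hc]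
    refine measure_mono_null ?_ h0
    rintro _ ⟨x, hx, rfl⟩
    exact hx
  have hs : (E ∩ Z).Countable :=
    (hY.preimage Subtype.val_injective).mono Set.inter_subset_right
  have hE : (E ∩ Z : Set U) =ᵐ[ν] E := inter_ae_eq_left_of_ae_eq_univ (by
    rwa [ae_eq_univ])
  rw [← Measure.restrict_congr_set hE, lintegral_countable _ hs,
    tsum_subtype (E ∩ Z) fun x => D x * ν {x}, tsum_subtype E fun x : U => D x * μ {x.1}]
  refine tsum_congr fun x => ?_
  have hx1 : ν {x} = μ {x.1} := by rw [hc, Set.image_singleton]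
  by_cases hx : x ∈ E
  · by_cases hy : x ∈ Z
    · simp [hx, hy, hx1]
    · have : μ {x.1} = 0 := measure_mono_null (Set.singleton_subset_iff.mpr hy) h0
      simp [hx, hy, this]
  · simp [hx]

/-- A measure concentrated on a countable set is conformal if and only if it is so on singletons. -/
theorem isConformal_iff_of_countable {U : Set X} (hU : MeasurableSet U) (hY : Y.Countable)
    (h0 : μ Yᶜ = 0) (σ : U → X) (D : U → ℝ≥0) :
    IsConformal σ D μ ↔ ∀ x, μ {σ x} = D x * μ {x.1} := by
  constructor
  · intro h x
    have h1 := h {x} (by simp) (Set.injOn_singleton _ _)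
    rw [Set.image_singleton, setLIntegral_comap_eq_tsum hU hY h0 (fun x => (D x : ℝ≥0∞)),
      tsum_singleton x fun x : U => (D x : ℝ≥0∞) * μ {x.1}] at h1
    exact h1
  · intro h E _ hinj
    rw [setLIntegral_comap_eq_tsum hU hY h0 (fun x => (D x : ℝ≥0∞)),
      -- Injectivity of `σ` on `E` turns the sum over `σ(E)` into a sum over `E`.
      measure_eq_tsum_of_countable hY h0, tsum_image (fun y => μ {y}) hinj]
    exact tsum_congr fun x => h x

end Atomic

/-! ### The space of the renewal shift: `ξ⁰` and its tree of preimages. -/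

section Renewal

theorem renewal_eq_one {i j : ℕ+} : renewal i j = 1 ↔ i = 1 ∨ i = j + 1 := by
  unfold renewal
  split_ifs with h <;> simp [h]

theorem sourceProj_one : sourceProj renewal 1 = 1 := Subtype.ext Q_renewal_one

/-- The letter `n + 1`, being different from `1`, can only be followed by `n`. -/
theorem sourceProj_add_one (n : ℕ+) : sourceProj renewal (n + 1) = letterProj renewal n := by
  classical
  apply Subtype.ext
  rw [coe_letterProj]
  change Q renewal (n + 1) = _
  ext v x
  rw [Q_apply, mul_apply_eq_comp, T_apply]
  by_cases h : x.1 0 = n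
  · rw [if_pos h, if_pos (renewal_eq_one.mpr (by simp [h])), T_star_apply,
      dif_pos (tail_edge x n h), cons_tail x n h]
  · rw [if_neg h, if_neg]
    rw [renewal_eq_one]
    rintro (h1 | h1)
    · exact absurd h1 (by simp [← PNat.coe_inj])
    · exact h (add_right_cancel h1).symm

/-- When every range projection vanishes, so do the generators with nonempty word, and the `Q_i` are
determined too: `Q_1 = 1`, and every other `Q_i` is a range projection. -/
theorem eq_of_notMem_shiftDomain {φ ψ : XA} (hφ : φ ∉ shiftDomain renewal)
    (hψ : ψ ∉ shiftDomain renewal) : φ = ψ := by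
  rw [notMem_shiftDomain] at hφ hψ
  refine spec_ext ?_
  rintro _ ⟨α, F, rfl⟩
  cases α with
  | nil =>
    refine apply_generator_nil_congr (fun i => ?_) F
    rcases eq_or_ne i 1 with rfl | hi
    · rw [sourceProj_one, map_one, map_one]
    · obtain ⟨n, rfl⟩ := PNat.exists_eq_succ_of_ne_one hi
      rw [sourceProj_add_one, hφ, hψ]
  | cons s α => rw [generator_cons_eq, apply_conjMap, apply_conjMap ψ, hφ, hψ, zero_mul,
      zero_mul]

/-- The sequence `n, n - 1, …, 2, 1, 1, 1, …`. -/
def descending (n : ℕ+) : MarkovShift renewal :=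
  -- Natural subtraction stops at `0` and `toPNat'` sends `0` to `1`, so the sequence stays at `1`
  -- after its descent.
  ⟨fun j => ((n : ℕ) - j).toPNat', fun j => by
    rw [renewal_eq_one, ← PNat.coe_inj, ← PNat.coe_inj]
    simp only [Nat.toPNat'_coe, PNat.add_coe, PNat.one_coe]
    split_ifs <;> omega⟩

/-- By weak-`*` compactness, points of `Σ_A` whose first letter `n` tends to infinity have a limit
along a nonprincipal ultrafilter. A fixed letter `s` is the first letter of only one of them, so the
limit annihilates its range projection. -/
theorem exists_notMem_shiftDomain : ∃ φ : XA, φ ∉ shiftDomain renewal := by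
  let u : Ultrafilter XA := (hyperfilter ℕ+).map fun n => incl (descending n)
  refine ⟨u.lim, notMem_shiftDomain.mpr fun s => ?_⟩
  have h1 : Tendsto (fun n => incl (descending n)) (hyperfilter ℕ+ : Filter ℕ+) (𝓝 u.lim) :=
    u.le_nhds_lim
  have hc : Continuous fun φ : XA => φ (letterProj renewal s) :=
    (WeakDual.eval_continuous _).comp continuous_subtype_val
  refine tendsto_nhds_unique ((hc.tendsto _).comp h1) (tendsto_const_nhds.congr' ?_)
  have h2 : ∀ᶠ n in (hyperfilter ℕ+ : Filter ℕ+), n ≠ s :=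
    hyperfilter_le_cofinite (Set.finite_singleton s).compl_mem_cofinite
  filter_upwards [h2] with n hn
  rw [Function.comp_apply, incl_letterProj, if_neg]
  intro h
  apply hn
  rw [← h]
  simp [descending]

/-- The point `ξ⁰` with empty stem. -/
def xiZero : XA := exists_notMem_shiftDomain.choose

theorem xiZero_notMem : xiZero ∉ shiftDomain renewal := exists_notMem_shiftDomain.choose_spec

/-- The points of `X_A` with finite nonempty stem, indexed by binary strings: `b :: l` stands for
the point obtained from that of `l` by adding in front the letter `1` if `b` is true, and the
successor of the first letter if `b` is false. -/
def stemPoint : List Bool → shiftDomain renewal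
  | [] => ⟨branch 1 xiZero (by rw [sourceProj_one, map_one]), branch_mem _ _ _⟩
  | true :: l => ⟨branch 1 (stemPoint l).1 (by rw [sourceProj_one, map_one]), branch_mem _ _ _⟩
  | false :: l => ⟨branch (firstLetter (stemPoint l) + 1) (stemPoint l).1
      (by rw [sourceProj_add_one, apply_letterProj_firstLetter]), branch_mem _ _ _⟩

theorem shiftMap_stemPoint_nil : shiftMap (stemPoint []) = xiZero := shiftMap_branch _ _ _

theorem shiftMap_stemPoint_cons (b : Bool) (l : List Bool) :
    shiftMap (stemPoint (b :: l)) = (stemPoint l).1 := by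
  cases b <;> exact shiftMap_branch _ _ _

theorem firstLetter_stemPoint_nil : firstLetter (stemPoint []) = 1 := firstLetter_branch _ _ _

theorem firstLetter_stemPoint_true (l : List Bool) : firstLetter (stemPoint (true :: l)) = 1 :=
  firstLetter_branch _ _ _

theorem firstLetter_stemPoint_false (l : List Bool) :
    firstLetter (stemPoint (false :: l)) = firstLetter (stemPoint l) + 1 :=
  firstLetter_branch _ _ _

/-- The shift removes the leading bit, which can be read off from whether the first letter is `1`.
Strings of different lengths are separated because `ξ⁰` cannot be shifted. -/
theorem stemPoint_injective : Function.Injective stemPoint := by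
  intro l
  induction l with
  | nil =>
    intro m h
    cases m with
    | nil => rfl
    | cons b m =>
      have h1 := congrArg shiftMap h
      rw [shiftMap_stemPoint_nil, shiftMap_stemPoint_cons] at h1
      exact absurd (h1 ▸ (stemPoint m).2) xiZero_notMem
  | cons b l ih =>
    intro m h
    have h1 := congrArg shiftMap h
    cases m with
    | nil =>
      rw [shiftMap_stemPoint_nil, shiftMap_stemPoint_cons] at h1
      exact absurd (h1 ▸ (stemPoint l).2) xiZero_notMem
    | cons c m =>
      rw [shiftMap_stemPoint_cons, shiftMap_stemPoint_cons] at h1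
      have h2 := ih (Subtype.ext h1)
      subst h2
      have h3 := congrArg firstLetter h
      cases b <;> cases c
      · rfl
      · rw [firstLetter_stemPoint_true, firstLetter_stemPoint_false] at h3
        exact absurd h3 (by simp [← PNat.coe_inj])
      · rw [firstLetter_stemPoint_true, firstLetter_stemPoint_false] at h3
        exact absurd h3 (by simp [← PNat.coe_inj])
      · rfl

/-- The points with finite stem, with `none` for the empty stem. -/
def finitePoint : Option (List Bool) → XA
  | none => xiZero
  | some l => (stemPoint l).1

theorem finitePoint_injective : Function.Injective finitePoint := by
  rintro (_ | l) (_ | m) h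
  · rfl
  · have h : xiZero = (stemPoint m).1 := h
    exact absurd (h ▸ (stemPoint m).2) xiZero_notMem
  · have h : (stemPoint l).1 = xiZero := h
    exact absurd (h ▸ (stemPoint l).2) xiZero_notMem
  · rw [stemPoint_injective (Subtype.ext h)]

/-- For the forward implication, the admissible letters over a point of the tree are `1` and, away
from `ξ⁰`, the successor of its first letter. These are the branches used in `stemPoint`, and a
branch is determined by its letter and its image. -/
theorem shiftMap_mem_range_iff (φ : shiftDomain renewal) :
    shiftMap φ ∈ Set.range finitePoint ↔ φ.1 ∈ Set.range finitePoint := by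
  constructor
  · rintro ⟨_ | l, h⟩
    · refine ⟨some [], congrArg Subtype.val (eq_of_shiftMap_eq ?_ ?_ : stemPoint [] = φ)⟩
      · rw [firstLetter_stemPoint_nil]
        by_contra hne
        obtain ⟨n, hn⟩ := PNat.exists_eq_succ_of_ne_one (Ne.symm hne)
        have h1 := shiftMap_sourceProj φ
        rw [← h, hn, sourceProj_add_one] at h1
        exact xiZero_notMem (mem_shiftDomain h1)
      · rw [shiftMap_stemPoint_nil]; exact h
    · have h : (stemPoint l).1 = shiftMap φ := h
      by_cases h1 : firstLetter φ = 1
      · refine ⟨some (true :: l),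
          congrArg Subtype.val (eq_of_shiftMap_eq ?_ ?_ : stemPoint (true :: l) = φ)⟩
        · rw [firstLetter_stemPoint_true, h1]
        · rw [shiftMap_stemPoint_cons, h]
      · refine ⟨some (false :: l),
          congrArg Subtype.val (eq_of_shiftMap_eq ?_ ?_ : stemPoint (false :: l) = φ)⟩
        · obtain ⟨n, hn⟩ := PNat.exists_eq_succ_of_ne_one h1
          have h2 := shiftMap_sourceProj φ
          rw [← h, hn, sourceProj_add_one] at h2
          rw [firstLetter_stemPoint_false, firstLetter_eq _ h2, hn]
        · rw [shiftMap_stemPoint_cons, h]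
  · rintro ⟨_ | l, h⟩
    · have h : xiZero = φ.1 := h
      exact absurd (h ▸ φ.2) xiZero_notMem
    · obtain rfl : stemPoint l = φ := Subtype.ext h
      cases l with
      | nil => exact ⟨none, shiftMap_stemPoint_nil.symm⟩
      | cons b l => exact ⟨some l, (shiftMap_stemPoint_cons b l).symm⟩

/-- Points of `Σ_A` remain in `Σ_A` under the shift, whereas a stem point eventually reaches `ξ⁰`.
-/
theorem stemPoint_notMem_shiftPoints (l : List Bool) :
    (stemPoint l).1 ∉ shiftPoints renewal := by
  induction l with
  | nil =>
    rintro ⟨ω, h⟩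
    have h1 : (⟨incl ω, incl_mem ω⟩ : shiftDomain renewal) = stemPoint [] := Subtype.ext h
    have h2 := congrArg shiftMap h1
    rw [shiftMap_incl, shiftMap_stemPoint_nil] at h2
    exact xiZero_notMem (h2 ▸ incl_mem _)
  | cons b l ih =>
    rintro ⟨ω, h⟩
    have h1 : (⟨incl ω, incl_mem ω⟩ : shiftDomain renewal) = stemPoint (b :: l) := Subtype.ext h
    have h2 := congrArg shiftMap h1
    rw [shiftMap_incl, shiftMap_stemPoint_cons] at h2
    exact ih ⟨_, h2⟩

/-- `X_A` is the disjoint union of `Σ_A` and the points with finite stem. -/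
theorem compl_range_finitePoint : (Set.range finitePoint)ᶜ = shiftPoints renewal := by
  ext φ
  constructor
  · intro hφ
    have key : ∀ χ : XA, χ ∉ Set.range finitePoint → χ ∈ shiftDomain renewal := fun χ h => by
      by_contra h1
      exact h ⟨none, eq_of_notMem_shiftDomain xiZero_notMem h1⟩
    -- The complement of the tree is invariant and avoids `ξ⁰`, so the shift can be iterated on it
    -- indefinitely.
    let step : {χ : XA // χ ∉ Set.range finitePoint} → {χ : XA // χ ∉ Set.range finitePoint} :=
      fun χ => ⟨shiftMap ⟨χ.1, key χ.1 χ.2⟩, fun h => χ.2 ((shiftMap_mem_range_iff _).mp h)⟩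
    let Φ : ℕ → shiftDomain renewal := fun n => ⟨(step^[n] ⟨φ, hφ⟩).1, key _ (step^[n] ⟨φ, hφ⟩).2⟩
    exact mem_shiftPoints_of_orbit Φ fun n => by
      simp only [Φ, Function.iterate_succ_apply']
      rfl
  · rintro h ⟨_ | l, rfl⟩
    · obtain ⟨ω, hω⟩ := h
      have hω : incl ω = xiZero := hω
      exact xiZero_notMem (hω ▸ incl_mem ω)
    · exact stemPoint_notMem_shiftPoints l h

end Renewal

/-! ### Total weight of the tree and the conformal measures it carries. -/

section Weights

/-- The weights of the finite stem points relative to that of `ξ⁰`. -/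
def stemWeight (D : shiftDomain renewal → ℝ≥0) : List Bool → ℝ≥0∞
  | [] => (D (stemPoint []) : ℝ≥0∞)⁻¹
  | b :: l => (D (stemPoint (b :: l)) : ℝ≥0∞)⁻¹ * stemWeight D l

/-- The weights of the points with finite stem, normalized to be `1` at `ξ⁰`. -/
def finiteWeight (D : shiftDomain renewal → ℝ≥0) : Option (List Bool) → ℝ≥0∞
  | none => 1
  | some l => stemWeight D l

theorem stemWeight_le {D : shiftDomain renewal → ℝ≥0} {r : ℝ≥0∞}
    (h : ∀ x, (D x : ℝ≥0∞)⁻¹ ≤ r) (l : List Bool) : stemWeight D l ≤ r ^ (l.length + 1) := by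
  induction l with
  | nil => simpa [stemWeight] using h _
  | cons b l ih =>
    rw [stemWeight, List.length_cons, pow_succ']
    exact mul_le_mul' (h _) ih

theorem le_stemWeight {D : shiftDomain renewal → ℝ≥0} {r : ℝ≥0∞}
    (h : ∀ x, r ≤ (D x : ℝ≥0∞)⁻¹) (l : List Bool) : r ^ (l.length + 1) ≤ stemWeight D l := by
  induction l with
  | nil => simpa [stemWeight] using h _
  | cons b l ih =>
    rw [stemWeight, List.length_cons, pow_succ']
    exact mul_le_mul' (h _) ih

/-- Grouping by length gives `2^n` strings of length `n`, hence a geometric series of ratio `2r`.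
Truncated subtraction makes `(1 - 2 * r)⁻¹` infinite when `2r ≥ 1`, so one formula covers both
regimes. -/
theorem tsum_pow_length (r : ℝ≥0∞) :
    ∑' l : List Bool, r ^ (l.length + 1) = r * (1 - 2 * r)⁻¹ := by
  rw [← (Equiv.sigmaFiberEquiv (List.length (α := Bool))).tsum_eq, ENNReal.tsum_sigma']
  have h : ∀ n : ℕ, ∑' l : {l : List Bool // l.length = n},
      r ^ ((Equiv.sigmaFiberEquiv (List.length (α := Bool)) ⟨n, l⟩).length + 1) =
      r * (2 * r) ^ n := by
    intro n
    have h1 : ∀ l : {l : List Bool // l.length = n},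
        r ^ ((Equiv.sigmaFiberEquiv (List.length (α := Bool)) ⟨n, l⟩).length + 1) =
          r ^ (n + 1) := fun l => by
      change r ^ (l.1.length + 1) = _
      rw [l.2]
    rw [tsum_congr h1]
    change ∑' _ : List.Vector Bool n, r ^ (n + 1) = _
    rw [tsum_fintype, Finset.sum_const, Finset.card_univ, card_vector, Fintype.card_bool,
      nsmul_eq_mul, mul_pow, pow_succ']
    push_cast
    ring
  rw [tsum_congr h, ENNReal.tsum_mul_left, ENNReal.tsum_geometric]

theorem tsum_finiteWeight (D : shiftDomain renewal → ℝ≥0) :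
    ∑' i, finiteWeight D i = 1 + ∑' l, stemWeight D l := by
  rw [← (Equiv.optionEquivSumPUnit.{0} (List Bool)).symm.tsum_eq,
    Summable.tsum_sum ENNReal.summable ENNReal.summable, add_comm]
  simp [finiteWeight]

theorem tsum_finiteWeight_ne_top {D : shiftDomain renewal → ℝ≥0} {r : ℝ≥0∞}
    (h : ∀ x, (D x : ℝ≥0∞)⁻¹ ≤ r) (hr : 2 * r < 1) : ∑' i, finiteWeight D i ≠ ∞ := by
  rw [tsum_finiteWeight]
  refine ENNReal.add_ne_top.mpr ⟨ENNReal.one_ne_top, ne_top_of_le_ne_top ?_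
    (ENNReal.tsum_le_tsum (stemWeight_le h))⟩
  rw [tsum_pow_length]
  refine ENNReal.mul_ne_top ?_ (ENNReal.inv_ne_top.mpr (tsub_pos_of_lt hr).ne')
  rintro rfl
  simp at hr

theorem tsum_finiteWeight_eq_top {D : shiftDomain renewal → ℝ≥0} {r : ℝ≥0∞}
    (h : ∀ x, r ≤ (D x : ℝ≥0∞)⁻¹) (hr : 1 ≤ 2 * r) : ∑' i, finiteWeight D i = ∞ := by
  rw [tsum_finiteWeight, ENNReal.add_eq_top]
  right
  refine top_le_iff.mp (le_trans ?_ (ENNReal.tsum_le_tsum (le_stemWeight h)))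
  rw [tsum_pow_length, tsub_eq_zero_of_le hr, ENNReal.inv_zero, ENNReal.mul_top]
  -- The case `r = 0`, where the product with `∞` would be `0`, is excluded by `1 ≤ 2 * r`.
  rintro rfl
  simp at hr

theorem countable_range_finitePoint : (Set.range finitePoint).Countable :=
  Set.countable_range _

theorem isConformal_iff {D : shiftDomain renewal → ℝ≥0} {μ : Measure XA}
    (h0 : μ (shiftPoints renewal) = 0) :
    IsConformal shiftMap D μ ↔ ∀ x, μ {shiftMap x} = D x * μ {x.1} :=
  isConformal_iff_of_countable isOpen_shiftDomain.measurableSet countable_range_finitePoint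
    (compl_range_finitePoint ▸ h0) _ _

/-- As `D` is finite and nonzero, the relation on singletons can be solved for `μ{x}` and iterated
down the string to `ξ⁰`. -/
theorem measure_finitePoint {D : shiftDomain renewal → ℝ≥0} (hD : ∀ x, D x ≠ 0) {μ : Measure XA}
    (h0 : μ (shiftPoints renewal) = 0) (h : IsConformal shiftMap D μ) (i : Option (List Bool)) :
    μ {finitePoint i} = finiteWeight D i * μ {xiZero} := by
  rw [isConformal_iff h0] at h
  have h' : ∀ x, μ {x.1} = (D x : ℝ≥0∞)⁻¹ * μ {shiftMap x} := fun x => by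
    rw [h, ← mul_assoc, ENNReal.inv_mul_cancel (by simpa using hD x) ENNReal.coe_ne_top, one_mul]
  cases i with
  | none => simp [finitePoint, finiteWeight]
  | some l =>
    change μ {(stemPoint l).1} = stemWeight D l * μ {xiZero}
    induction l with
    | nil => rw [h', shiftMap_stemPoint_nil, stemWeight]
    | cons b l ih => rw [h', shiftMap_stemPoint_cons, ih, stemWeight, mul_assoc]

theorem measure_univ_eq_tsum {μ : Measure XA} (h0 : μ (shiftPoints renewal) = 0) :
    μ Set.univ = ∑' i, μ {finitePoint i} := by
  rw [← compl_range_finitePoint] at h0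
  rw [← measure_iUnion (fun i j hij => Set.disjoint_singleton.mpr (finitePoint_injective.ne hij))
    fun i => measurableSet_singleton _, Set.iUnion_singleton_eq_range, ← measure_inter_conull h0,
    Set.univ_inter]

/-- Total mass `1` expressed through the single unknown `μ{ξ⁰}`; both uniqueness and nonexistence
follow from this identity. -/
theorem tsum_finiteWeight_mul {D : shiftDomain renewal → ℝ≥0} (hD : ∀ x, D x ≠ 0)
    {μ : Measure XA} [IsProbabilityMeasure μ] (h0 : μ (shiftPoints renewal) = 0)
    (h : IsConformal shiftMap D μ) : (∑' i, finiteWeight D i) * μ {xiZero} = 1 := by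
  rw [← ENNReal.tsum_mul_right, ← measure_univ (μ := μ), measure_univ_eq_tsum h0]
  exact tsum_congr fun i => (measure_finitePoint hD h0 h i).symm

theorem not_isConformal_of_tsum_eq_top {D : shiftDomain renewal → ℝ≥0} (hD : ∀ x, D x ≠ 0)
    (hZ : ∑' i, finiteWeight D i = ∞) {μ : Measure XA} [IsProbabilityMeasure μ]
    (h0 : μ (shiftPoints renewal) = 0) : ¬ IsConformal shiftMap D μ := by
  intro h
  have h1 := tsum_finiteWeight_mul hD h0 h
  rw [hZ] at h1
  -- The product of `∞` with the mass of `ξ⁰` is `0` or `∞`, never `1`.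
  rcases eq_or_ne (μ {xiZero}) 0 with h2 | h2
  · simp [h2] at h1
  · simp [ENNReal.top_mul h2] at h1

theorem isConformal_unique {D : shiftDomain renewal → ℝ≥0} (hD : ∀ x, D x ≠ 0)
    {μ ν : Measure XA} [IsProbabilityMeasure μ] [IsProbabilityMeasure ν]
    (hμ0 : μ (shiftPoints renewal) = 0) (hμ : IsConformal shiftMap D μ)
    (hν0 : ν (shiftPoints renewal) = 0) (hν : IsConformal shiftMap D ν) : μ = ν := by
  have h1 : μ {xiZero} = ν {xiZero} := by
    rw [ENNReal.eq_inv_of_mul_eq_one_left ((mul_comm _ _).trans (tsum_finiteWeight_mul hD hμ0 hμ)),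
      ENNReal.eq_inv_of_mul_eq_one_left ((mul_comm _ _).trans (tsum_finiteWeight_mul hD hν0 hν))]
  refine Measure.ext fun S _ => ?_
  rw [← compl_range_finitePoint] at hμ0 hν0
  rw [measure_eq_tsum_of_countable countable_range_finitePoint hμ0,
    measure_eq_tsum_of_countable countable_range_finitePoint hν0]
  refine tsum_congr fun x => ?_
  by_cases hx : x.1 ∈ Set.range finitePoint
  · obtain ⟨i, hi⟩ := hx
    rw [compl_range_finitePoint] at hμ0 hν0
    rw [← hi, measure_finitePoint hD hμ0 hμ, measure_finitePoint hD hν0 hν, h1]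
  · rw [measure_mono_null (Set.singleton_subset_iff.mpr hx) hμ0,
      measure_mono_null (Set.singleton_subset_iff.mpr hx) hν0]

/-- The atomic measure with weights `finiteWeight D`, normalized. -/
def atomicMeasure (D : shiftDomain renewal → ℝ≥0) : Measure XA :=
  (∑' i, finiteWeight D i)⁻¹ •
    Measure.sum fun i => finiteWeight D i • Measure.dirac (finitePoint i)

open Classical in
theorem atomicMeasure_apply (D : shiftDomain renewal → ℝ≥0) (S : Set XA) :
    atomicMeasure D S = (∑' i, finiteWeight D i)⁻¹ *
      ∑' i, if finitePoint i ∈ S then finiteWeight D i else 0 := by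
  rw [atomicMeasure, Measure.smul_apply, Measure.sum_apply_of_countable, smul_eq_mul]
  congr 1
  refine tsum_congr fun i => ?_
  by_cases h : finitePoint i ∈ S <;> simp [h]

theorem atomicMeasure_finitePoint (D : shiftDomain renewal → ℝ≥0) (i : Option (List Bool)) :
    atomicMeasure D {finitePoint i} = (∑' i, finiteWeight D i)⁻¹ * finiteWeight D i := by
  classical
  rw [atomicMeasure_apply]
  congr 1
  rw [tsum_eq_single i]
  · simp
  · intro j hj
    rw [if_neg]
    exact fun h => hj (finitePoint_injective h)

theorem atomicMeasure_shiftPoints (D : shiftDomain renewal → ℝ≥0) :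
    atomicMeasure D (shiftPoints renewal) = 0 := by
  classical
  rw [atomicMeasure_apply, ← compl_range_finitePoint]
  simp

theorem isProbabilityMeasure_atomicMeasure {D : shiftDomain renewal → ℝ≥0}
    (hZ : ∑' i, finiteWeight D i ≠ ∞) : IsProbabilityMeasure (atomicMeasure D) := by
  classical
  constructor
  rw [atomicMeasure_apply]
  simp only [Set.mem_univ, if_true]
  refine ENNReal.inv_mul_cancel ?_ hZ
  rw [tsum_finiteWeight]
  simp

/-- On the tree the defining recursion of the weights is the conformality relation; off it,
invariance of the tree makes both sides zero. Finiteness plays no role: with infinite total weight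
the normalizing factor, and so the measure, is zero. -/
theorem isConformal_atomicMeasure {D : shiftDomain renewal → ℝ≥0} (hD : ∀ x, D x ≠ 0) :
    IsConformal shiftMap D (atomicMeasure D) := by
  have h0 := atomicMeasure_shiftPoints D
  rw [isConformal_iff h0]
  intro x
  by_cases hx : x.1 ∈ Set.range finitePoint
  · obtain ⟨_ | l, hl⟩ := hx
    · have hl : xiZero = x.1 := hl
      exact absurd (hl ▸ x.2) xiZero_notMem
    · obtain rfl : stemPoint l = x := Subtype.ext hl
      have hc : ∀ y, (D y : ℝ≥0∞) * (D y : ℝ≥0∞)⁻¹ = 1 := fun y =>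
        ENNReal.mul_inv_cancel (by simpa using hD y) ENNReal.coe_ne_top
      have h1 := atomicMeasure_finitePoint D (some l)
      change atomicMeasure D {(stemPoint l).1} = _ * stemWeight D l at h1
      rw [h1, mul_left_comm]
      cases l with
      | nil =>
        rw [shiftMap_stemPoint_nil, stemWeight, hc]
        exact atomicMeasure_finitePoint D none
      | cons b l =>
        rw [shiftMap_stemPoint_cons, stemWeight, ← mul_assoc (D _ : ℝ≥0∞), hc, one_mul]
        exact atomicMeasure_finitePoint D (some l)
  · have hσ := mt (shiftMap_mem_range_iff x).mp hx
    rw [← compl_range_finitePoint] at h0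
    rw [measure_mono_null (Set.singleton_subset_iff.mpr hx) h0,
      measure_mono_null (Set.singleton_subset_iff.mpr hσ) h0, mul_zero]

theorem inv_toNNReal_exp (t : ℝ) :
    ((Real.toNNReal (Real.exp t) : ℝ≥0∞))⁻¹ = ENNReal.ofReal (Real.exp (-t)) := by
  rw [Real.exp_neg, ENNReal.ofReal_inv_of_pos (Real.exp_pos t)]
  rfl

theorem two_mul_ofReal_exp_lt_one {t : ℝ} (h : Real.log 2 < t) :
    2 * ENNReal.ofReal (Real.exp (-t)) < 1 := by
  rw [← ENNReal.ofReal_ofNat 2, ← ENNReal.ofReal_mul zero_le_two, ENNReal.ofReal_lt_one,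
    Real.exp_neg, ← div_eq_mul_inv, div_lt_one (Real.exp_pos t)]
  rwa [← Real.log_lt_iff_lt_exp two_pos]

theorem one_le_two_mul_ofReal_exp {t : ℝ} (h : t ≤ Real.log 2) :
    1 ≤ 2 * ENNReal.ofReal (Real.exp (-t)) := by
  rw [← ENNReal.ofReal_ofNat 2, ← ENNReal.ofReal_mul zero_le_two, ENNReal.one_le_ofReal,
    Real.exp_neg, ← div_eq_mul_inv, one_le_div (Real.exp_pos t)]
  rwa [← Real.le_log_iff_exp_le two_pos]

end Weights

end ExelLaca

end

/-! ### The theorem on the two temperature regimes. -/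

theorem mainTheorem2
    (f : ExelLaca.shiftDomain ExelLaca.renewal → ℝ)
    (hf : ∀ ξ η, ExelLaca.firstLetter ξ = ExelLaca.firstLetter η → f ξ = f η)
    (hbdd : ∃ C : ℝ, ∀ ξ, |f ξ| ≤ C)
    (M : ℝ) (hM : 0 < M) (hfM : ∀ ξ, M ≤ f ξ)
    (β : ℝ) (hβ : 0 < β) :
    (Real.log 2 / M < β →
      ∃! μ : MeasureTheory.Measure ExelLaca.XA,
        MeasureTheory.IsProbabilityMeasure μ ∧
        ExelLaca.IsConformal ExelLaca.shiftMap (fun ξ => Real.toNNReal (Real.exp (β * f ξ))) μ ∧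
        μ (ExelLaca.shiftPoints ExelLaca.renewal) = 0) ∧
    (β < Real.log 2 / (⨆ ξ, |f ξ|) →
      ¬ ∃ μ : MeasureTheory.Measure ExelLaca.XA,
        MeasureTheory.IsProbabilityMeasure μ ∧
        ExelLaca.IsConformal ExelLaca.shiftMap (fun ξ => Real.toNNReal (Real.exp (β * f ξ))) μ ∧
        μ (ExelLaca.shiftPoints ExelLaca.renewal) = 0) := by
  open ExelLaca in
  have hD : ∀ ξ, Real.toNNReal (Real.exp (β * f ξ)) ≠ 0 := fun ξ =>
    (Real.toNNReal_pos.mpr (Real.exp_pos _)).ne'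
  constructor
  · intro h
    have hZ : ∑' i, finiteWeight (fun ξ => Real.toNNReal (Real.exp (β * f ξ))) i ≠ ⊤ := by
      -- `f ≥ M` bounds every factor `e^{-βf}` by `r = e^{-βM}`, and `β > log 2 / M` means `2r < 1`.
      refine tsum_finiteWeight_ne_top (r := ENNReal.ofReal (Real.exp (-(β * M)))) (fun ξ => ?_)
        (two_mul_ofReal_exp_lt_one ((div_lt_iff₀ hM).mp h))
      rw [inv_toNNReal_exp]
      exact ENNReal.ofReal_le_ofReal (Real.exp_le_exp.mpr
        (neg_le_neg (mul_le_mul_of_nonneg_left (hfM ξ) hβ.le)))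
    refine ⟨atomicMeasure _, ⟨isProbabilityMeasure_atomicMeasure hZ, isConformal_atomicMeasure hD,
      atomicMeasure_shiftPoints _⟩, ?_⟩
    rintro μ ⟨hp, hc, h0⟩
    have := isProbabilityMeasure_atomicMeasure hZ
    exact isConformal_unique hD h0 hc (atomicMeasure_shiftPoints _) (isConformal_atomicMeasure hD)
  · rintro h ⟨μ, hp, hc, h0⟩
    obtain ⟨C, hC⟩ := hbdd
    -- Boundedness is essential here: the real supremum of an unbounded family takes a default value
    -- and dominates nothing.
    have hle : ∀ ξ, |f ξ| ≤ ⨆ ξ, |f ξ| := le_ciSup ⟨C, Set.forall_mem_range.mpr hC⟩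
    -- Clearing the denominator requires a positive supremum, and a concrete stem point shows that
    -- the domain is nonempty.
    have hpos : 0 < ⨆ ξ, |f ξ| :=
      hM.trans_le ((hfM (stemPoint [])).trans ((le_abs_self _).trans (hle _)))
    refine not_isConformal_of_tsum_eq_top hD ?_ h0 hc
    refine tsum_finiteWeight_eq_top (r := ENNReal.ofReal (Real.exp (-(β * ⨆ ξ, |f ξ|))))
      -- Only `β‖f‖ ≤ log 2` is needed, since the series also diverges at the critical ratio `2r =
      -- 1`.
      (fun ξ => ?_) (one_le_two_mul_ofReal_exp ((lt_div_iff₀ hpos).mp h).le)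
    rw [inv_toNNReal_exp]
    exact ENNReal.ofReal_le_ofReal (Real.exp_le_exp.mpr
      (neg_le_neg (mul_le_mul_of_nonneg_left ((le_abs_self _).trans (hle ξ)) hβ.le)))
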